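/- Let $\mathcal S_4\subset\mathbb P^3_{\mathbb C}$ be the Schur quartic surface $x_0^4-x_0x_1^3-x_2^4+x_2x_3^3=0$. A line on $\mathcal S_4$ is said to be of the first kind if it meets both of the axes $\{x_2=x_3=0\}$ and $\{x_0=x_1=0\}$, and of the second kind otherwise. A transversal arrangement of lines on a smooth quartic surface is a finite set of lines on the surface such that any two of them are disjoint or meet transversally and such that the union of the lines is connected. For a transversal arrangement $\mathcal C$ of $n$ lines on a smooth quartic (hence K3) surface $X$ let $t_k$ be the number of points of $X$ that lie on exactly $k$ lines of $\mathcal C$, and put $f_0=\sum_{k\ge 2}t_k$, $f_1=\sum_{k\ge2}k\,t_k$. Let $Y\to X$ be the blow-up at the points that lie on at least three lines of $\mathcal C$, and let $\widetilde{\mathcal C}$ be the reduced total transform of $\mathcal C$. The log Chern slope of the log surface $(Y,\widetilde{\mathcal C})$ is defined as $$E(Y,\widetilde{\mathcal C})=\frac{\bar c_1^2}{\bar c_2}=\frac{-2n+3f_1-4f_0}{24-2n+f_1-f_0}.$$ **Proposition.** The surface $\mathcal S_4$ is smooth and contains exactly $64$ lines, $16$ of the first kind and $48$ of the second kind. The $48$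 lines of the second kind form a transversal arrangement with exactly $t_2=144$ double points and $t_3=64$ triple points, and with $t_k=0$ for all $k\ge4$. Hence the log Chern slope of the associated log surface is $$E(Y,\widetilde{\mathcal C})=\frac{64}{25}=2.56,\qquad \frac52<E(Y,\widetilde{\mathcal C})<\frac83 .$$ Moreover, there is exactly one transversal arrangement $\mathcal C$ of $48$ lines on $\mathcal S_4$ such that $E(Y,\widetilde{\mathcal C})=2.56$. -/

import Mathlib

open MvPolynomial

noncomputable section

namespace SchurQuarticLines

/-- The vector space `ℂ⁴` of homogeneous coordinates `(x₀, x₁, x₂, x₃)` on complex `ℙ³`. -/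
abbrev V : Type := Fin 4 → ℂ

/-- Complex projective three-space. -/
abbrev P3 : Type := Projectivization ℂ V

/-- The classical topology of `ℙ³`: the quotient topology from `ℂ⁴ ∖ {0}`. -/
instance : TopologicalSpace P3 :=
  TopologicalSpace.coinduced (Projectivization.mk' ℂ) inferInstance

/-- The surface `F = 0` in `ℙ³` is a smooth quartic: `F` is homogeneous of degree four and its
partial derivatives have no common zero on the surface. Such a surface is a projective K3
surface. -/
def IsSmoothQuartic (F : MvPolynomial (Fin 4) ℂ) : Prop :=
  F ≠ 0 ∧ F.IsHomogeneous 4 ∧ ∀ v : V, v ≠ 0 → eval v F = 0 → ∃ i, eval v (pderiv i F) ≠ 0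

/-- Lines of `ℙ³` are two-dimensional linear subspaces of `ℂ⁴`; this is the set of the lines that
are contained in the surface `F = 0`. -/
def linesOn (F : MvPolynomial (Fin 4) ℂ) : Set (Submodule ℂ V) :=
  {L | Module.finrank ℂ L = 2 ∧ ∀ v ∈ L, eval v F = 0}

/-- The linear subspace of `ℂ⁴` of which the projectivization is the embedded tangent space of the
surface `F = 0` at the point with homogeneous coordinates `v`. -/
def tangentSpace (F : MvPolynomial (Fin 4) ℂ) (v : V) : Submodule ℂ V :=
  LinearMap.ker (∑ i, eval v (pderiv i F) • (LinearMap.proj i : V →ₗ[ℂ] ℂ))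

/-- The set of points of `ℙ³` that lie on some line of `C`. -/
def unionOfLines (C : Set (Submodule ℂ V)) : Set P3 :=
  {p | ∃ L ∈ C, p.submodule ≤ L}

/-- A transversal arrangement of lines on the surface `F = 0`: a finite set of lines on the
surface (which are smooth irreducible rational curves) such that any two distinct lines meet
transversally wherever they meet (their tangent lines span the tangent plane of the surface), and
such that the union of the lines is connected. -/
structure IsTransversalArrangement (F : MvPolynomial (Fin 4) ℂ) (C : Set (Submodule ℂ V)) :
    Prop where
  finite : C.Finite
  subset : C ⊆ linesOn F
  transversal : ∀ L ∈ C, ∀ M ∈ C, L ≠ M → ∀ v ∈ L ⊓ M, v ≠ 0 → L ⊔ M = tangentSpace F v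
  connected : IsConnected (unionOfLines C)

/-- The number of lines of `C` through the point `p`. -/
def multiplicity (C : Set (Submodule ℂ V)) (p : P3) : ℕ :=
  {L ∈ C | p.submodule ≤ L}.ncard

/-- `t C k` is the number of `k`-fold points of `C` (used for `k ≥ 2`): the points through which
exactly `k` lines of `C` pass. -/
def t (C : Set (Submodule ℂ V)) (k : ℕ) : ℕ :=
  {p : P3 | multiplicity C p = k}.ncard

/-- `f₀ = ∑ t_k` over `k ≥ 2`; no point of a finite set `C` has a multiplicity above its
cardinality. -/
def f₀ (C : Set (Submodule ℂ V)) : ℕ := ∑ k ∈ Finset.Icc 2 C.ncard, t C k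

/-- `f₁ = ∑ k t_k` over `k ≥ 2`. -/
def f₁ (C : Set (Submodule ℂ V)) : ℕ := ∑ k ∈ Finset.Icc 2 C.ncard, k * t C k

/-- The first log Chern number `-2n + 3f₁ - 4f₀` of the log surface associated with a transversal
arrangement of `n` smooth rational curves on a K3 surface. -/
def logChernOneSq (C : Set (Submodule ℂ V)) : ℤ := -2 * C.ncard + 3 * f₁ C - 4 * f₀ C

/-- The second log Chern number `24 - 2n + f₁ - f₀` of the log surface associated with a
transversal arrangement of `n` smooth rational curves on a K3 surface. -/
def logChernTwo (C : Set (Submodule ℂ V)) : ℤ := 24 - 2 * C.ncard + f₁ C - f₀ C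

/-- The log Chern slope of the log surface associated with a transversal arrangement of smooth
rational curves on a K3 surface. -/
def logChernSlope (C : Set (Submodule ℂ V)) : ℚ := (logChernOneSq C : ℚ) / (logChernTwo C : ℚ)

/-- The form `x₀⁴ - x₀x₁³ - x₂⁴ + x₂x₃³` that defines the Schur quartic surface. -/
def schurQuartic : MvPolynomial (Fin 4) ℂ :=
  X 0 ^ 4 - X 0 * X 1 ^ 3 - X 2 ^ 4 + X 2 * X 3 ^ 3

/-- The axis `x₂ = x₃ = 0`. -/
def axisA : Submodule ℂ V :=
  LinearMap.ker (LinearMap.proj 2 : V →ₗ[ℂ] ℂ) ⊓ LinearMap.ker (LinearMap.proj 3 : V →ₗ[ℂ] ℂ)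

/-- The axis `x₀ = x₁ = 0`. -/
def axisB : Submodule ℂ V :=
  LinearMap.ker (LinearMap.proj 0 : V →ₗ[ℂ] ℂ) ⊓ LinearMap.ker (LinearMap.proj 1 : V →ₗ[ℂ] ℂ)

/-- The lines of the first kind on the Schur quartic: those that join a point of the surface on one
axis to a point of the surface on the other axis. -/
def firstKind : Set (Submodule ℂ V) :=
  {L ∈ linesOn schurQuartic | L ⊓ axisA ≠ ⊥ ∧ L ⊓ axisB ≠ ⊥}

/-- The lines of the second kind on the Schur quartic: all its other lines. -/
def secondKind : Set (Submodule ℂ V) := linesOn schurQuartic \ firstKind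

end SchurQuarticLines

end

noncomputable section

namespace SchurQuarticLines

/-! The equation of the surface reads f(x₀, x₁) = f(x₂, x₃) with the binary quartic f = x⁴ - xy³. A
line that misses the axis x₀ = x₁ = 0 is the graph of a linear map M of ℂ², and it lies on the
surface exactly when M preserves f; a direct solution of the coefficient equations gives 48 such M
(`mem_quarticSymmetries_iff`). Because the zeros of f are simple, a line on the surface that meets
this axis meets the other one too (`inf_axisA_ne_bot`), so it joins one of the four zeros of f on
each axis; this gives 4 · 4 = 16 more lines.

The graphs of M and N meet over v exactly when Mv = Nv. Hence the number of lines of the second kind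
through (v, Mv) is the order of the stabilizer of v in the group of symmetries
(`multiplicity_secondKind_mk`). This order is 3 over the four zeros of the Hessian of f, 2 over the
six zeros of its sextic covariant, and 1 elsewhere. Every line of the second kind thus carries 4
triple and 6 double points, and counting incidences gives t₃ = 48 · 4 / 3 and t₂ = 48 · 6 / 2.
Transversality holds because two lines through a point of a smooth surface span its tangent plane;
connectedness follows from chains of meeting graphs that lead to the graph of the identity.

For uniqueness, slope 64/25 with n = 48 amounts to 36f₀ - 11f₁ = 2208, so a k-fold point with k ≥ 2
has weight 36 - 11k. A competitor arises from the lines of the second kind by exchanging a set D of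
them for equally many lines of the first kind. The pointwise estimate `pointWeight_exchange`, summed
over incidences, shows that twice the weight gains at least 328 for every line brought in and loses
at most 292 for every line removed. As the weight must not change, D is empty. -/

/-! ### The symmetry group of the binary quartic `x⁴ - xy³` -/

/-- The binary quartic form `x⁴ - xy³`. -/
def binaryQuartic (v : Fin 2 → ℂ) : ℂ := v 0 ^ 4 - v 0 * v 1 ^ 3

/-- The `2 × 2` matrices that preserve the binary quartic `x⁴ - xy³`. -/
def quarticSymmetries : Set (Matrix (Fin 2) (Fin 2) ℂ) :=
  {M | ∀ v, binaryQuartic (M.mulVec v) = binaryQuartic v}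

/-- The diagonal symmetry with lower right entry `d`. -/
def diagSymmetry (d : ℂ) : Matrix (Fin 2) (Fin 2) ℂ := !![(d ^ 3)⁻¹, 0; 0, d]

/-- The symmetry with second column `(b, κ b)`. -/
def offDiagSymmetry (b κ : ℂ) : Matrix (Fin 2) (Fin 2) ℂ :=
  !![-(9 * b ^ 3)⁻¹, b; 2 * κ * (9 * b ^ 3)⁻¹, κ * b]

theorem finite_setOf_pow_eq {n : ℕ} (hn : n ≠ 0) (c : ℂ) : {x : ℂ | x ^ n = c}.Finite := by
  refine (Polynomial.nthRoots n c).toFinset.finite_toSet.subset fun x hx => ?_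
  simpa [Polynomial.mem_nthRoots (Nat.pos_of_ne_zero hn)] using hx

theorem ncard_setOf_pow_eq {n : ℕ} (hn : n ≠ 0) {c : ℂ} (hc : c ≠ 0) :
    {x : ℂ | x ^ n = c}.ncard = n := by
  have hp := Complex.isPrimitiveRoot_exp n hn
  obtain ⟨a, ha⟩ := IsAlgClosed.exists_pow_nat_eq c (Nat.pos_of_ne_zero hn)
  have hset : {x : ℂ | x ^ n = c} = (Polynomial.nthRoots n c).toFinset := by
    ext x
    simp [Polynomial.mem_nthRoots (Nat.pos_of_ne_zero hn)]
  rw [hset, Set.ncard_coe_finset, Multiset.toFinset_card_of_nodup (hp.nthRoots_nodup hc),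
    hp.card_nthRoots, if_pos ⟨a, ha⟩]

/-- A binary quartic form is determined by its values at five pairwise non-proportional vectors, so
five evaluations recover the coefficients. The equation for x²y² is divided by 3. -/
theorem mem_quarticSymmetries_iff_coeff {M : Matrix (Fin 2) (Fin 2) ℂ} :
    M ∈ quarticSymmetries ↔
      M 0 0 ^ 4 - M 0 0 * M 1 0 ^ 3 = 1 ∧
      4 * M 0 0 ^ 3 * M 0 1 - M 0 1 * M 1 0 ^ 3 - 3 * M 0 0 * M 1 0 ^ 2 * M 1 1 = 0 ∧
      2 * M 0 0 ^ 2 * M 0 1 ^ 2 - M 0 1 * M 1 0 ^ 2 * M 1 1 - M 0 0 * M 1 0 * M 1 1 ^ 2 = 0 ∧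
      4 * M 0 0 * M 0 1 ^ 3 - 3 * M 0 1 * M 1 0 * M 1 1 ^ 2 - M 0 0 * M 1 1 ^ 3 = -1 ∧
      M 0 1 ^ 4 - M 0 1 * M 1 1 ^ 3 = 0 := by
  have key : ∀ v : Fin 2 → ℂ, binaryQuartic (M.mulVec v) =
      (M 0 0 * v 0 + M 0 1 * v 1) ^ 4
        - (M 0 0 * v 0 + M 0 1 * v 1) * (M 1 0 * v 0 + M 1 1 * v 1) ^ 3 := by
    intro v
    simp [binaryQuartic, Matrix.mulVec, dotProduct, Fin.sum_univ_two]
  constructor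
  · intro h
    have h0 := h ![1, 0]
    have h1 := h ![0, 1]
    have h2 := h ![1, 1]
    have h3 := h ![1, -1]
    have h4 := h ![2, 1]
    rw [key] at h0 h1 h2 h3 h4
    simp only [binaryQuartic, Matrix.cons_val_zero, Matrix.cons_val_one] at h0 h1 h2 h3 h4
    refine ⟨?_, ?_, ?_, ?_, ?_⟩
    · linear_combination h0
    · linear_combination (-2) * h0 + (1 / 2) * h1 - (1 / 2) * h2 - (1 / 6) * h3 + (1 / 6) * h4
    · linear_combination (-1 / 3) * h0 - (1 / 3) * h1 + (1 / 6) * h2 + (1 / 6) * h3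
    · linear_combination 2 * h0 - (1 / 2) * h1 + h2 - (1 / 3) * h3 - (1 / 6) * h4
    · linear_combination h1
  · rintro ⟨h0, h1, h2, h3, h4⟩ v
    rw [key, binaryQuartic]
    linear_combination (v 0) ^ 4 * h0 + (v 0) ^ 3 * v 1 * h1 + 3 * (v 0) ^ 2 * (v 1) ^ 2 * h2
      + v 0 * (v 1) ^ 3 * h3 + (v 1) ^ 4 * h4

theorem diagSymmetry_mem {d : ℂ} (hd : d ^ 12 = 1) : diagSymmetry d ∈ quarticSymmetries := by
  have h0 : d ≠ 0 := by rintro rfl; norm_num at hd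
  rw [mem_quarticSymmetries_iff_coeff]
  simp only [diagSymmetry, Matrix.of_apply, Matrix.cons_val', Matrix.cons_val_zero,
    Matrix.cons_val_one, Matrix.cons_val_fin_one]
  refine ⟨?_, by ring, by ring, ?_, by ring⟩
  · field_simp
    linear_combination -hd
  · field_simp
    norm_num

/-- With a = (9b³)⁻¹, the negative of the upper left entry, the value of b¹² says exactly that 9a⁴ =
1: indeed (9b³)⁴ = 6561/729 = 9. -/
theorem offDiagSymmetry_mem {b κ : ℂ} (hb : b ^ 12 = 729⁻¹) (hκ : κ ^ 3 = 1) :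
    offDiagSymmetry b κ ∈ quarticSymmetries := by
  have h0 : b ≠ 0 := by rintro rfl; norm_num at hb
  have ha : ∃ a, a = (9 * b ^ 3)⁻¹ ∧ 9 * b ^ 3 * a = 1 ∧ 9 * a ^ 4 = 1 := by
    refine ⟨_, rfl, by field_simp, ?_⟩
    field_simp
    norm_num at hb ⊢
    linear_combination (-729) * hb
  obtain ⟨a, ha, hab, ha4⟩ := ha
  rw [mem_quarticSymmetries_iff_coeff]
  simp only [offDiagSymmetry, ← ha, Matrix.of_apply, Matrix.cons_val', Matrix.cons_val_zero,
    Matrix.cons_val_one, Matrix.cons_val_fin_one]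
  refine ⟨?_, ?_, ?_, ?_, ?_⟩
  · linear_combination ha4 + 8 * a ^ 4 * hκ
  · linear_combination 4 * a ^ 3 * b * hκ
  · linear_combination (-2) * a^2 * b^2 * hκ
  · linear_combination (-1) * hab - 5 * a * b^3 * hκ
  · linear_combination - b^4 * hκ

/-- The second column (b, d) must again be a zero of the form, so b = 0 or d = κb with κ³ = 1. If b
= 0, the matrix is forced to be diagonal. Otherwise the coefficient of x²y² factors as (2aκ + c)(aκ
- c); the root c = aκ would make the form vanish on the first column, where its value is 1, so c =
-2aκ. -/
theorem mem_quarticSymmetries_iff {M : Matrix (Fin 2) (Fin 2) ℂ} :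
    M ∈ quarticSymmetries ↔ (∃ d : ℂ, d ^ 12 = 1 ∧ M = diagSymmetry d) ∨
      ∃ b κ : ℂ, b ^ 12 = 729⁻¹ ∧ κ ^ 3 = 1 ∧ M = offDiagSymmetry b κ := by
  constructor
  · intro h
    obtain ⟨h0, h1, h2, h3, h4⟩ := mem_quarticSymmetries_iff_coeff.1 h
    have hM : M = !![M 0 0, M 0 1; M 1 0, M 1 1] := Matrix.eta_fin_two M
    generalize M 0 0 = a at *
    generalize M 0 1 = b at *
    generalize M 1 0 = c at *
    generalize M 1 1 = d at *
    subst hM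
    have ha : a ≠ 0 := by rintro rfl; norm_num at h0
    by_cases hb : b = 0
    · subst hb
      left
      have had : a * d ^ 3 = 1 := by linear_combination -h3
      have hd : d ≠ 0 := by rintro rfl; norm_num at had
      have hc : c = 0 := by
        have : (3 * a * d) * c ^ 2 = 0 := by linear_combination -h1
        simpa [ha, hd] using this
      subst hc
      refine ⟨d, ?_, ?_⟩
      · linear_combination (-d^12) * h0 + (a^3*d^9 + a^2*d^6+a*d^3+1) * had
      · rw [diagSymmetry, eq_inv_of_mul_eq_one_left had]
    · right
      have hbd : b ^ 3 = d ^ 3 := by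
        apply mul_left_cancel₀ hb; linear_combination h4
      have hd : d ≠ 0 := by rintro rfl; exact hb (by simpa using hbd)
      obtain ⟨κ, hκ⟩ : ∃ κ, d = κ * b := ⟨d / b, by field_simp⟩
      subst hκ
      have hκ3 : κ ^ 3 = 1 := by
        apply mul_right_cancel₀ (pow_ne_zero 3 hb); linear_combination -hbd
      have hκ0 : κ ≠ 0 := by rintro rfl; norm_num at hκ3
      have hq : (2 * a * κ + c) * (a * κ - c) = 0 := by
        apply mul_left_cancel₀ (mul_ne_zero (pow_ne_zero 2 hb) hκ0)
        linear_combination h2 + 2 * a^2 * b^2 * hκ3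
      have hc : c = -2 * a * κ := by
        rcases mul_eq_zero.1 hq with hq | hq
        · linear_combination hq
        · exfalso
          have hc : c = a * κ := by linear_combination -hq
          subst hc
          have : (0 : ℂ) = 1 := by linear_combination h0 + a^4 * hκ3
          norm_num at this
      subst hc
      have ha4 : 9 * a ^ 4 = 1 := by linear_combination h0 - 8 * a^4 * hκ3
      have hab : 9 * b ^ 3 * (-a) = 1 := by linear_combination -h3 + 5 * a * b^3 * hκ3
      have hinv : (9 * b ^ 3)⁻¹ = -a := inv_eq_of_mul_eq_one_right hab
      refine ⟨b, κ, ?_, hκ3, ?_⟩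
      · have : (9 * b ^ 3 * (-a)) ^ 4 = 1 := by rw [hab]; norm_num
        norm_num
        linear_combination (1 / 729) * this - b^12 * ha4
      · rw [offDiagSymmetry, hinv]
        congr! 4 <;> ring
  · rintro (⟨d, hd, rfl⟩ | ⟨b, κ, hb, hκ, rfl⟩)
    · exact diagSymmetry_mem hd
    · exact offDiagSymmetry_mem hb hκ

theorem quarticSymmetries_eq : quarticSymmetries = diagSymmetry '' {d | d ^ 12 = 1} ∪
    (fun q : ℂ × ℂ => offDiagSymmetry q.1 q.2) '' ({b | b ^ 12 = 729⁻¹} ×ˢ {κ | κ ^ 3 = 1}) := by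
  ext M
  rw [mem_quarticSymmetries_iff]
  constructor
  · rintro (⟨d, hd, rfl⟩ | ⟨b, κ, hb, hκ, rfl⟩)
    · exact Or.inl ⟨d, hd, rfl⟩
    · exact Or.inr ⟨(b, κ), ⟨hb, hκ⟩, rfl⟩
  · rintro (⟨d, hd, rfl⟩ | ⟨⟨b, κ⟩, ⟨hb, hκ⟩, rfl⟩)
    · exact Or.inl ⟨d, hd, rfl⟩
    · exact Or.inr ⟨b, κ, hb, hκ, rfl⟩

theorem ncard_quarticSymmetries : quarticSymmetries.ncard = 48 := by
  have e1 : (diagSymmetry '' {d | d ^ 12 = 1}).ncard = 12 := by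
    rw [Set.ncard_image_of_injective, ncard_setOf_pow_eq (by norm_num) one_ne_zero]
    intro d d' h
    simpa [diagSymmetry] using congrFun (congrFun h 1) 1
  have e2 : ((fun q : ℂ × ℂ => offDiagSymmetry q.1 q.2) ''
      ({b | b ^ 12 = 729⁻¹} ×ˢ {κ | κ ^ 3 = 1})).ncard = 36 := by
    rw [Set.InjOn.ncard_image, Set.ncard_prod, ncard_setOf_pow_eq (by norm_num) (by norm_num),
      ncard_setOf_pow_eq (by norm_num) (by norm_num)]
    rintro ⟨b, κ⟩ ⟨hb, -⟩ ⟨b', κ'⟩ - h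
    have h0 : b ≠ 0 := by rintro rfl; norm_num at hb
    have h1 : b = b' := by simpa [offDiagSymmetry] using congrFun (congrFun h 0) 1
    subst h1
    have h2 : κ = κ' := by simpa [offDiagSymmetry, h0] using congrFun (congrFun h 1) 1
    rw [h2]
  rw [quarticSymmetries_eq, Set.ncard_union_eq _ (((finite_setOf_pow_eq (by norm_num) _).image _))
    (((finite_setOf_pow_eq (by norm_num) _).prod (finite_setOf_pow_eq (by norm_num) _)).image _),
    e1, e2]
  rw [Set.disjoint_left]
  rintro M ⟨d, -, rfl⟩ ⟨⟨b, κ⟩, ⟨hb, -⟩, h⟩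
  have h1 : b = 0 := by simpa [diagSymmetry, offDiagSymmetry] using congrFun (congrFun h 0) 1
  subst h1
  norm_num at hb

theorem one_mem_quarticSymmetries : (1 : Matrix (Fin 2) (Fin 2) ℂ) ∈ quarticSymmetries := by
  intro v; simp

theorem mul_mem_quarticSymmetries {M N : Matrix (Fin 2) (Fin 2) ℂ} (hM : M ∈ quarticSymmetries)
    (hN : N ∈ quarticSymmetries) : M * N ∈ quarticSymmetries := by
  intro v
  rw [← Matrix.mulVec_mulVec, hM, hN]

theorem isUnit_det_of_mem {M : Matrix (Fin 2) (Fin 2) ℂ} (hM : M ∈ quarticSymmetries) :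
    IsUnit M.det := by
  rw [isUnit_iff_ne_zero]
  rcases mem_quarticSymmetries_iff.1 hM with ⟨d, hd, rfl⟩ | ⟨b, κ, hb, hκ, rfl⟩
  · have h0 : d ≠ 0 := by rintro rfl; norm_num at hd
    simp [diagSymmetry, h0]
  · have h0 : b ≠ 0 := by rintro rfl; norm_num at hb
    have h1 : κ ≠ 0 := by rintro rfl; norm_num at hκ
    have : (offDiagSymmetry b κ).det = -3 * (9 * b ^ 3)⁻¹ * b * κ := by
      simp [offDiagSymmetry, Matrix.det_fin_two]; ring
    rw [this]
    simp [h0, h1]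

theorem inv_mem_quarticSymmetries {M : Matrix (Fin 2) (Fin 2) ℂ} (hM : M ∈ quarticSymmetries) :
    M⁻¹ ∈ quarticSymmetries := by
  intro v
  have h := hM (M⁻¹.mulVec v)
  rw [Matrix.mulVec_mulVec, Matrix.mul_nonsing_inv _ (isUnit_det_of_mem hM),
    Matrix.one_mulVec] at h
  exact h.symm

/-- The symmetries that fix the vector `v`. -/
def fixer (v : Fin 2 → ℂ) : Set (Matrix (Fin 2) (Fin 2) ℂ) :=
  {M ∈ quarticSymmetries | M.mulVec v = v}

/-- The symmetries that agree with M at v form the left coset of the stabilizer of v by M. -/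
theorem ncard_setOf_mulVec_eq {M : Matrix (Fin 2) (Fin 2) ℂ} (hM : M ∈ quarticSymmetries)
    (v : Fin 2 → ℂ) :
    {N ∈ quarticSymmetries | N.mulVec v = M.mulVec v}.ncard = (fixer v).ncard := by
  have hu := isUnit_det_of_mem hM
  have : {N ∈ quarticSymmetries | N.mulVec v = M.mulVec v} = (fun N => M * N) '' fixer v := by
    ext N
    constructor
    · rintro ⟨hN, h⟩
      refine ⟨M⁻¹ * N, ⟨mul_mem_quarticSymmetries (inv_mem_quarticSymmetries hM) hN, ?_⟩, ?_⟩
      · rw [← Matrix.mulVec_mulVec, h, Matrix.mulVec_mulVec, Matrix.nonsing_inv_mul _ hu,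
          Matrix.one_mulVec]
      · exact Matrix.mul_nonsing_inv_cancel_left _ _ hu
    · rintro ⟨K, ⟨hK, h⟩, rfl⟩
      exact ⟨mul_mem_quarticSymmetries hM hK, by rw [← Matrix.mulVec_mulVec, h]⟩
  rw [this, Set.ncard_image_of_injective]
  intro A B h
  have := congrArg (fun N => M⁻¹ * N) h
  simpa [Matrix.nonsing_inv_mul_cancel_left _ _ hu] using this

theorem fixer_smul {s : ℂ} (hs : s ≠ 0) (v : Fin 2 → ℂ) : fixer (s • v) = fixer v := by
  ext M
  simp only [fixer, Set.mem_ofPred_eq, Matrix.mulVec_smul]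
  rw [smul_right_injective _ hs |>.eq_iff]

/-! ### Stabilizers of vectors -/

/-- The symmetry other than the identity with upper left entry `e⁻¹` that fixes `(1, y)`. -/
def fixingSymmetry (y e : ℂ) : Matrix (Fin 2) (Fin 2) ℂ :=
  offDiagSymmetry ((e - 1) / (e * y)) (e * y / (e - 3))

theorem ne_of_pow_four_eq_nine {e : ℂ} (he : e ^ 4 = 9) : e ≠ 0 ∧ e ≠ 1 ∧ e ≠ 3 := by
  refine ⟨?_, ?_, ?_⟩ <;> rintro rfl <;> norm_num at he

theorem fixingSymmetry_cube {y e : ℂ} (hy : y ≠ 0) (he : e ^ 4 = 9) (hye : (1 - e) ^ 3 = y ^ 3) :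
    ((e - 1) / (e * y)) ^ 3 = -e / 9 := by
  obtain ⟨h0, h1, h3⟩ := ne_of_pow_four_eq_nine he
  field_simp
  linear_combination (-9) * hye + y ^ 3 * he

theorem fixingSymmetry_apply_zero_zero {y e : ℂ} (hy : y ≠ 0) (he : e ^ 4 = 9)
    (hye : (1 - e) ^ 3 = y ^ 3) : fixingSymmetry y e 0 0 = e⁻¹ := by
  simp only [fixingSymmetry, offDiagSymmetry, fixingSymmetry_cube hy he hye, Matrix.of_apply,
    Matrix.cons_val_zero]
  rw [← inv_neg]
  congr 1
  ring

theorem fixingSymmetry_mem_fixer {y e : ℂ} (hy : y ≠ 0) (he : e ^ 4 = 9)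
    (hye : (1 - e) ^ 3 = y ^ 3) : fixingSymmetry y e ∈ fixer ![1, y] := by
  obtain ⟨h0, h1, h3⟩ := ne_of_pow_four_eq_nine he
  have h3' : e - 3 ≠ 0 := sub_ne_zero.2 h3
  have hc := fixingSymmetry_cube hy he hye
  refine ⟨offDiagSymmetry_mem ?_ ?_, ?_⟩
  · have : ((e - 1) / (e * y)) ^ 12 = (((e - 1) / (e * y)) ^ 3) ^ 4 := by ring
    rw [this, hc]
    norm_num
    linear_combination (1 / 6561) * he
  · rw [div_pow, div_eq_one_iff_eq (pow_ne_zero 3 h3')]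
    linear_combination (-e ^ 3) * hye + (3 * e - 3 - e ^ 2) * he
  · simp only [fixingSymmetry, offDiagSymmetry, hc]
    ext i
    fin_cases i
    · simp [Matrix.mulVec, dotProduct, Fin.sum_univ_two]
      field_simp
      ring
    · simp [Matrix.mulVec, dotProduct, Fin.sum_univ_two]
      field_simp
      ring

/-- A diagonal symmetry that fixes (1, y) with y ≠ 0 is the identity. For the others, put e = -9b³,
so that e⁴ = 9 and the upper left entry is e⁻¹; the two rows of the fixed vector equation then give
b and κ in terms of e and y, and b³ = -e/9 becomes (1 - e)³ = y³. -/
theorem fixer_one_eq {y : ℂ} (hy : y ≠ 0) :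
    fixer ![1, y] = insert 1 (fixingSymmetry y '' {e | e ^ 4 = 9 ∧ (1 - e) ^ 3 = y ^ 3}) := by
  ext M
  constructor
  · rintro ⟨hM, hv⟩
    rcases mem_quarticSymmetries_iff.1 hM with ⟨d, hd, rfl⟩ | ⟨b, κ, hb, hκ, rfl⟩
    · left
      have hv0 := congrFun hv 0
      have hv1 := congrFun hv 1
      simp [diagSymmetry, Matrix.mulVec, dotProduct, Fin.sum_univ_two, hy] at hv0 hv1
      subst hv1
      simp [diagSymmetry, Matrix.one_fin_two]
    · right
      have h0 : b ≠ 0 := by rintro rfl; norm_num at hb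
      have hv0 := congrFun hv 0
      have hv1 := congrFun hv 1
      simp only [offDiagSymmetry, Matrix.mulVec, dotProduct, Fin.sum_univ_two, Matrix.of_apply,
        Matrix.cons_val', Matrix.cons_val_zero, Matrix.cons_val_one, Matrix.cons_val_fin_one,
        mul_one] at hv0 hv1
      obtain ⟨e, hbe⟩ : ∃ e : ℂ, b ^ 3 = -e / 9 := ⟨-9 * b ^ 3, by ring⟩
      have he : e ^ 4 = 9 := by
        have : b ^ 12 = (b ^ 3) ^ 4 := by ring
        rw [this, hbe] at hb
        norm_num at hb
        linear_combination 6561 * hb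
      obtain ⟨he0, he1, he3⟩ := ne_of_pow_four_eq_nine he
      have h3' : e - 3 ≠ 0 := sub_ne_zero.2 he3
      have hinv : (9 * b ^ 3)⁻¹ = -e⁻¹ := by
        rw [hbe, ← inv_neg]; congr 1; ring
      rw [hinv] at hv0 hv1
      have hb' : b = (e - 1) / (e * y) := by
        field_simp
        field_simp at hv0
        linear_combination hv0
      have hκ' : κ = e * y / (e - 3) := by
        subst hb'
        field_simp
        field_simp at hv1
        linear_combination hv1
      refine ⟨e, ⟨he, ?_⟩, by rw [fixingSymmetry, ← hb', ← hκ']⟩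
      rw [hb', div_pow, div_eq_iff (by simp [he0, hy])] at hbe
      linear_combination -hbe + y ^ 3 / 9 * he
  · rintro (rfl | ⟨e, ⟨he, hye⟩, rfl⟩)
    · exact ⟨one_mem_quarticSymmetries, by simp⟩
    · exact fixingSymmetry_mem_fixer hy he hye

theorem ncard_fixer_one_eq {y : ℂ} (hy : y ≠ 0) :
    (fixer ![1, y]).ncard = {e : ℂ | e ^ 4 = 9 ∧ (1 - e) ^ 3 = y ^ 3}.ncard + 1 := by
  have hfin : {e : ℂ | e ^ 4 = 9 ∧ (1 - e) ^ 3 = y ^ 3}.Finite :=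
    (finite_setOf_pow_eq (n := 4) (by norm_num) 9).subset fun _ h => h.1
  rw [fixer_one_eq hy, Set.ncard_insert_of_notMem _ (hfin.image _), Set.InjOn.ncard_image]
  · rintro e ⟨he, hye⟩ e' ⟨he', hye'⟩ h
    have := congrFun (congrFun h 0) 0
    rwa [fixingSymmetry_apply_zero_zero hy he hye, fixingSymmetry_apply_zero_zero hy he' hye',
      inv_inj] at this
  · rintro ⟨e, ⟨he, hye⟩, h⟩
    obtain ⟨h0, h1, h3⟩ := ne_of_pow_four_eq_nine he
    have := congrFun (congrFun h 0) 0
    rw [fixingSymmetry_apply_zero_zero hy he hye] at this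
    simp [h1] at this

/-- From e⁴ = 9 follows e² = -3 or e² = 3. In the first case (1 - e)³ = -8 for both roots; in the
second (1 - e)³ = 10 - 6e, which is -8 only for the excluded value e = 3. -/
theorem ncard_setOf_cube_eq_neg_eight {z : ℂ} (hz : z = -8) :
    {e : ℂ | e ^ 4 = 9 ∧ (1 - e) ^ 3 = z}.ncard = 2 := by
  have : {e : ℂ | e ^ 4 = 9 ∧ (1 - e) ^ 3 = z} = {e | e ^ 2 = -3} := by
    ext e
    simp only [Set.mem_ofPred_eq]
    constructor
    · rintro ⟨he, hez⟩
      have h : (e ^ 2 + 3) * (e ^ 2 - 3) = 0 := by linear_combination he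
      rcases mul_eq_zero.1 h with h | h
      · linear_combination h
      · exfalso
        have h3 : e = 3 := by linear_combination (-1 / 6) * hez + (3 - e) / 6 * h - (1 / 6) * hz
        exact (ne_of_pow_four_eq_nine he).2.2 h3
    · intro he
      exact ⟨by linear_combination (e ^ 2 - 3) * he, by linear_combination (3 - e) * he - hz⟩
  rw [this, ncard_setOf_pow_eq (by norm_num) (by norm_num)]

/-- Only e² = 3 is possible here, and z = 10 - 6e then determines e; the hypothesis is 36e² = 108.
-/
theorem ncard_setOf_cube_eq_of_sq_eq {z : ℂ} (hz : (10 - z) ^ 2 = 108) :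
    {e : ℂ | e ^ 4 = 9 ∧ (1 - e) ^ 3 = z}.ncard = 1 := by
  rw [Set.ncard_eq_one]
  refine ⟨(10 - z) / 6, ?_⟩
  ext e
  simp only [Set.mem_ofPred_eq, Set.mem_singleton_iff]
  constructor
  · rintro ⟨he, hez⟩
    have h : (e ^ 2 + 3) * (e ^ 2 - 3) = 0 := by linear_combination he
    rcases mul_eq_zero.1 h with h | h
    · exfalso
      have : z = -8 := by linear_combination -hez + (3 - e) * h
      subst this
      norm_num at hz
    · linear_combination (-1 / 6) * hez + (3 - e) / 6 * h
  · rintro rfl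
    constructor
    · linear_combination ((10 - z) ^ 2 + 108) / 1296 * hz
    · linear_combination (8 + z) / 216 * hz

theorem setOf_cube_eq_eq_empty {z : ℂ} (h8 : z ≠ -8) (hz : (10 - z) ^ 2 ≠ 108) :
    {e : ℂ | e ^ 4 = 9 ∧ (1 - e) ^ 3 = z} = ∅ := by
  rw [Set.eq_empty_iff_forall_notMem]
  rintro e ⟨he, hez⟩
  have h : (e ^ 2 + 3) * (e ^ 2 - 3) = 0 := by linear_combination he
  rcases mul_eq_zero.1 h with h | h
  · exact h8 (by linear_combination -hez + (3 - e) * h)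
  · have : z = 10 - 6 * e := by linear_combination -hez + (3 - e) * h
    subst this
    exact hz (by linear_combination 36 * h)

theorem fixer_one_zero : (fixer ![1, 0]).ncard = 3 := by
  have : fixer ![1, 0] = diagSymmetry '' {d | d ^ 3 = 1} := by
    ext M
    constructor
    · rintro ⟨hM, hv⟩
      rcases mem_quarticSymmetries_iff.1 hM with ⟨d, hd, rfl⟩ | ⟨b, κ, hb, hκ, rfl⟩
      · have hv0 := congrFun hv 0
        simp [diagSymmetry, Matrix.mulVec, dotProduct, Fin.sum_univ_two] at hv0
        exact ⟨d, hv0, rfl⟩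
      · exfalso
        have h0 : b ≠ 0 := by rintro rfl; norm_num at hb
        have h1 : κ ≠ 0 := by rintro rfl; norm_num at hκ
        have hv1 := congrFun hv 1
        simp [offDiagSymmetry, Matrix.mulVec, dotProduct, Fin.sum_univ_two, h0, h1] at hv1
    · rintro ⟨d, hd, rfl⟩
      rw [Set.mem_ofPred_eq] at hd
      refine ⟨diagSymmetry_mem (by rw [show d ^ 12 = (d ^ 3) ^ 4 by ring, hd, one_pow]), ?_⟩
      ext i
      fin_cases i <;> simp [diagSymmetry, Matrix.mulVec, dotProduct, Fin.sum_univ_two, hd]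
  rw [this, Set.ncard_image_of_injective, ncard_setOf_pow_eq (by norm_num) one_ne_zero]
  intro d d' h
  simpa [diagSymmetry] using congrFun (congrFun h 1) 1

theorem fixer_zero_one : (fixer ![0, 1]).ncard = 1 := by
  have : fixer ![0, 1] = {1} := by
    ext M
    constructor
    · rintro ⟨hM, hv⟩
      have hv0 := congrFun hv 0
      have hv1 := congrFun hv 1
      rcases mem_quarticSymmetries_iff.1 hM with ⟨d, hd, rfl⟩ | ⟨b, κ, hb, hκ, rfl⟩
      · simp [diagSymmetry, Matrix.mulVec, dotProduct, Fin.sum_univ_two] at hv0 hv1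
        subst hv1
        simp [diagSymmetry, Matrix.one_fin_two]
      · exfalso
        simp [offDiagSymmetry, Matrix.mulVec, dotProduct, Fin.sum_univ_two] at hv0
        subst hv0
        norm_num at hb
    · rintro rfl
      exact ⟨one_mem_quarticSymmetries, by simp⟩
  rw [this, Set.ncard_singleton]

/-- Up to a constant, y(y³ + 8) is the Hessian of the quartic at (1, y). Likewise (10 - y³)² - 108 =
y⁶ - 20y³ - 8, which governs the stabilizers of order two, is its sextic covariant. -/
theorem ncard_fixer_one_eq_three {y : ℂ} (h : y * (y ^ 3 + 8) = 0) :
    (fixer ![1, y]).ncard = 3 := by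
  rcases eq_or_ne y 0 with rfl | hy
  · exact fixer_one_zero
  · rw [ncard_fixer_one_eq hy, ncard_setOf_cube_eq_neg_eight]
    linear_combination (mul_eq_zero.1 h).resolve_left hy

theorem ncard_fixer_one_eq_two {y : ℂ} (h : (10 - y ^ 3) ^ 2 = 108) :
    (fixer ![1, y]).ncard = 2 := by
  have hy : y ≠ 0 := by rintro rfl; norm_num at h
  rw [ncard_fixer_one_eq hy, ncard_setOf_cube_eq_of_sq_eq h]

theorem ncard_fixer_one_eq_one {y : ℂ} (h : y * (y ^ 3 + 8) ≠ 0) (h' : (10 - y ^ 3) ^ 2 ≠ 108) :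
    (fixer ![1, y]).ncard = 1 := by
  obtain ⟨hy, h8⟩ := mul_ne_zero_iff.1 h
  rw [ncard_fixer_one_eq hy, setOf_cube_eq_eq_empty (fun hz => h8 (by rw [hz]; norm_num)) h',
    Set.ncard_empty]

theorem ncard_fixer_one_eq_three_iff {y : ℂ} :
    (fixer ![1, y]).ncard = 3 ↔ y * (y ^ 3 + 8) = 0 := by
  refine ⟨fun h => ?_, ncard_fixer_one_eq_three⟩
  by_contra h3
  by_cases h2 : (10 - y ^ 3) ^ 2 = 108
  · rw [ncard_fixer_one_eq_two h2] at h; norm_num at h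
  · rw [ncard_fixer_one_eq_one h3 h2] at h; norm_num at h

theorem ncard_fixer_one_eq_two_iff {y : ℂ} :
    (fixer ![1, y]).ncard = 2 ↔ (10 - y ^ 3) ^ 2 = 108 := by
  refine ⟨fun h => ?_, ncard_fixer_one_eq_two⟩
  by_contra h2
  by_cases h3 : y * (y ^ 3 + 8) = 0
  · rw [ncard_fixer_one_eq_three h3] at h; norm_num at h
  · rw [ncard_fixer_one_eq_one h3 h2] at h; norm_num at h

theorem exists_smul_eq {v : Fin 2 → ℂ} (hv : v ≠ 0) :
    ∃ s : ℂ, s ≠ 0 ∧ (v = s • ![0, 1] ∨ ∃ y, v = s • ![1, y]) := by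
  by_cases h : v 0 = 0
  · refine ⟨v 1, fun h1 => hv ?_, Or.inl ?_⟩
    · ext i; fin_cases i <;> simp [h, h1]
    · ext i; fin_cases i <;> simp [h]
  · refine ⟨v 0, h, Or.inr ⟨v 1 / v 0, ?_⟩⟩
    ext i; fin_cases i
    · simp
    · simp; field_simp

theorem ncard_fixer_le {v : Fin 2 → ℂ} (hv : v ≠ 0) : (fixer v).ncard ≤ 3 := by
  obtain ⟨s, hs, rfl | ⟨y, rfl⟩⟩ := exists_smul_eq hv
  · rw [fixer_smul hs, fixer_zero_one]; norm_num
  · rw [fixer_smul hs]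
    by_cases h3 : y * (y ^ 3 + 8) = 0
    · rw [ncard_fixer_one_eq_three h3]
    by_cases h2 : (10 - y ^ 3) ^ 2 = 108
    · rw [ncard_fixer_one_eq_two h2]; norm_num
    · rw [ncard_fixer_one_eq_one h3 h2]; norm_num

/-! ### Zeros of the binary quartic -/

/-- Representatives of the four zeros of `x⁴ - xy³` on the projective line. -/
def quarticZeros : Set (Fin 2 → ℂ) := insert ![0, 1] ((fun η : ℂ => ![1, η]) '' {η | η ^ 3 = 1})

theorem ncard_quarticZeros : quarticZeros.ncard = 4 := by
  rw [quarticZeros, Set.ncard_insert_of_notMem _ ((finite_setOf_pow_eq (by norm_num) _).image _),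
    Set.ncard_image_of_injective, ncard_setOf_pow_eq (by norm_num) one_ne_zero]
  · intro η η' h
    simpa using congrFun h 1
  · rintro ⟨η, -, h⟩
    simpa using congrFun h 0

theorem finite_quarticZeros : quarticZeros.Finite :=
  Set.finite_of_ncard_ne_zero (by rw [ncard_quarticZeros]; norm_num)

theorem ne_zero_of_mem_quarticZeros {a : Fin 2 → ℂ} (ha : a ∈ quarticZeros) : a ≠ 0 := by
  rcases ha with rfl | ⟨η, -, rfl⟩ <;> simp

theorem binaryQuartic_of_mem_quarticZeros {a : Fin 2 → ℂ} (ha : a ∈ quarticZeros) :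
    binaryQuartic a = 0 := by
  rcases ha with rfl | ⟨η, hη, rfl⟩
  · simp [binaryQuartic]
  · rw [Set.mem_ofPred_eq] at hη
    simp [binaryQuartic, hη]

theorem eq_of_mem_quarticZeros {a b : Fin 2 → ℂ} (ha : a ∈ quarticZeros) (hb : b ∈ quarticZeros)
    (h : a 0 * b 1 = a 1 * b 0) : a = b := by
  rcases ha with rfl | ⟨η, -, rfl⟩ <;> rcases hb with rfl | ⟨η', -, rfl⟩ <;> simp_all

theorem exists_mem_quarticZeros {v : Fin 2 → ℂ} (hv : v ≠ 0) (h : binaryQuartic v = 0) :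
    ∃ a ∈ quarticZeros, ∃ s : ℂ, s ≠ 0 ∧ v = s • a := by
  obtain ⟨s, hs, rfl | ⟨y, rfl⟩⟩ := exists_smul_eq hv
  · exact ⟨_, Or.inl rfl, s, hs, rfl⟩
  · refine ⟨_, Or.inr ⟨y, ?_, rfl⟩, s, hs, rfl⟩
    simp only [binaryQuartic, Pi.smul_apply, Matrix.cons_val_zero, Matrix.cons_val_one,
      smul_eq_mul] at h
    apply mul_left_cancel₀ (pow_ne_zero 4 hs)
    linear_combination -h

theorem binaryQuartic_smul (s : ℂ) (v : Fin 2 → ℂ) :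
    binaryQuartic (s • v) = s ^ 4 * binaryQuartic v := by
  simp [binaryQuartic]; ring

theorem ncard_fixer_eq_one {v : Fin 2 → ℂ} (hv : v ≠ 0) (h : binaryQuartic v = 0) :
    (fixer v).ncard = 1 := by
  obtain ⟨a, ha, s, hs, rfl⟩ := exists_mem_quarticZeros hv h
  rw [fixer_smul hs]
  rcases ha with rfl | ⟨η, hη, rfl⟩
  · exact fixer_zero_one
  · rw [Set.mem_ofPred_eq] at hη
    have hη0 : η ≠ 0 := by rintro rfl; norm_num at hη
    exact ncard_fixer_one_eq_one (by rw [hη]; norm_num [hη0]) (by rw [hη]; norm_num)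

theorem exists_mulVec_zero_one {a : Fin 2 → ℂ} (ha : a ∈ quarticZeros) :
    ∃ M ∈ quarticSymmetries, ∃ s : ℂ, s ≠ 0 ∧ M.mulVec ![0, 1] = s • a := by
  rcases ha with rfl | ⟨η, hη, rfl⟩
  · exact ⟨1, one_mem_quarticSymmetries, 1, one_ne_zero, by simp⟩
  · obtain ⟨b, hb⟩ := IsAlgClosed.exists_pow_nat_eq (729⁻¹ : ℂ) (n := 12) (by norm_num)
    refine ⟨_, offDiagSymmetry_mem hb hη, b, ?_, ?_⟩
    · rintro rfl; norm_num at hb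
    · ext i
      fin_cases i <;> simp [offDiagSymmetry, Matrix.mulVec, dotProduct, Fin.sum_univ_two, mul_comm]

/-- All zeros of the form are equivalent to (0, 1) under the symmetries, and the diagonal ones scale
(0, 1) by the twelve twelfth roots of unity. Conjugating these between a and b yields twelve
factors. -/
theorem exists_ncard_eq_twelve_smul {a b : Fin 2 → ℂ} (ha : a ∈ quarticZeros)
    (hb : b ∈ quarticZeros) :
    ∃ T : Set ℂ, T.ncard = 12 ∧
      ∀ t ∈ T, ∃ M ∈ quarticSymmetries, M.mulVec a = t • b := by
  obtain ⟨A, hA, s, hs, hAs⟩ := exists_mulVec_zero_one ha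
  obtain ⟨B, hB, r, hr, hBr⟩ := exists_mulVec_zero_one hb
  have hrs : r / s ≠ 0 := div_ne_zero hr hs
  refine ⟨(fun d => d * (r / s)) '' {d | d ^ 12 = 1}, ?_, ?_⟩
  · rw [Set.ncard_image_of_injective _ (mul_left_injective₀ hrs),
      ncard_setOf_pow_eq (by norm_num) one_ne_zero]
  · rintro _ ⟨d, hd, rfl⟩
    rw [Set.mem_ofPred_eq] at hd
    refine ⟨B * diagSymmetry d * A⁻¹,
      mul_mem_quarticSymmetries (mul_mem_quarticSymmetries hB (diagSymmetry_mem hd))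
        (inv_mem_quarticSymmetries hA), ?_⟩
    have h1 : a = s⁻¹ • A.mulVec ![0, 1] := by rw [hAs, smul_smul, inv_mul_cancel₀ hs, one_smul]
    have h2 : (diagSymmetry d).mulVec ![0, 1] = d • ![0, 1] := by
      ext i
      fin_cases i <;> simp [diagSymmetry, Matrix.mulVec, dotProduct, Fin.sum_univ_two]
    rw [h1, Matrix.mulVec_smul, ← Matrix.mulVec_mulVec, Matrix.mulVec_mulVec _ A⁻¹ A,
      Matrix.nonsing_inv_mul _ (isUnit_det_of_mem hA), Matrix.one_mulVec, ← Matrix.mulVec_mulVec,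
      h2, Matrix.mulVec_smul, hBr, smul_smul, smul_smul]
    congr 1
    field_simp

theorem ncard_setOf_triple : {y : ℂ | y * (y ^ 3 + 8) = 0}.ncard = 4 := by
  have : {y : ℂ | y * (y ^ 3 + 8) = 0} = insert 0 {y | y ^ 3 = -8} := by
    ext y
    simp [add_eq_zero_iff_eq_neg]
  rw [this, Set.ncard_insert_of_notMem _ (finite_setOf_pow_eq (by norm_num) _),
    ncard_setOf_pow_eq (by norm_num) (by norm_num)]
  simp

theorem ncard_setOf_double : {y : ℂ | (10 - y ^ 3) ^ 2 = 108}.ncard = 6 := by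
  obtain ⟨s, hs⟩ := IsAlgClosed.exists_pow_nat_eq (108 : ℂ) (n := 2) (by norm_num)
  have : {y : ℂ | (10 - y ^ 3) ^ 2 = 108} = {y | y ^ 3 = 10 - s} ∪ {y | y ^ 3 = 10 + s} := by
    ext y
    simp only [Set.mem_ofPred_eq, Set.mem_union]
    rw [← hs, sq_eq_sq_iff_eq_or_eq_neg]
    constructor
    · rintro (h | h)
      · exact Or.inl (by linear_combination -h)
      · exact Or.inr (by linear_combination -h)
    · rintro (h | h)
      · exact Or.inl (by linear_combination -h)
      · exact Or.inr (by linear_combination -h)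
  have hprod : (10 - s) * (10 + s) ≠ 0 := by
    rw [show (10 - s) * (10 + s) = 100 - s ^ 2 by ring, hs]; norm_num
  obtain ⟨h1, h2⟩ := mul_ne_zero_iff.1 hprod
  rw [this, Set.ncard_union_eq _ (finite_setOf_pow_eq (by norm_num) _)
    (finite_setOf_pow_eq (by norm_num) _), ncard_setOf_pow_eq (by norm_num) h1,
    ncard_setOf_pow_eq (by norm_num) h2]
  rw [Set.disjoint_left]
  intro y hy hy'
  rw [Set.mem_ofPred_eq] at hy hy'
  have : s = 0 := by linear_combination (hy - hy') / 2
  subst this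
  norm_num at hs

/-! ### The lines on the Schur quartic -/

/-- The projection to the first two homogeneous coordinates. -/
def head : V →ₗ[ℂ] (Fin 2 → ℂ) := LinearMap.funLeft ℂ ℂ ![0, 1]

/-- The projection to the last two homogeneous coordinates. -/
def tail : V →ₗ[ℂ] (Fin 2 → ℂ) := LinearMap.funLeft ℂ ℂ ![2, 3]

/-- The vector with given first two and last two coordinates. -/
def join (v w : Fin 2 → ℂ) : V := ![v 0, v 1, w 0, w 1]

theorem head_apply (x : V) : head x = ![x 0, x 1] := by
  ext i; fin_cases i <;> rfl

theorem tail_apply (x : V) : tail x = ![x 2, x 3] := by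
  ext i; fin_cases i <;> rfl

@[simp] theorem head_join (v w : Fin 2 → ℂ) : head (join v w) = v := by
  ext i; fin_cases i <;> rfl

@[simp] theorem tail_join (v w : Fin 2 → ℂ) : tail (join v w) = w := by
  ext i; fin_cases i <;> rfl

theorem ext_head_tail {x y : V} (h : head x = head y) (h' : tail x = tail y) : x = y := by
  ext i
  fin_cases i
  · exact congrFun h 0
  · exact congrFun h 1
  · exact congrFun h' 0
  · exact congrFun h' 1

theorem join_head_tail (x : V) : join (head x) (tail x) = x :=
  ext_head_tail (by simp) (by simp)

theorem eval_schurQuartic (x : V) :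
    eval x schurQuartic = binaryQuartic (head x) - binaryQuartic (tail x) := by
  simp [schurQuartic, binaryQuartic, head_apply, tail_apply]
  ring

@[simp] theorem binaryQuartic_zero : binaryQuartic 0 = 0 := by
  simp [binaryQuartic]

theorem mem_axisA {x : V} : x ∈ axisA ↔ tail x = 0 := by
  simp [axisA, tail_apply]

theorem mem_axisB {x : V} : x ∈ axisB ↔ head x = 0 := by
  simp [axisB, head_apply]

/-- The line that is the graph of a `2 × 2` matrix. -/
def graphLine (M : Matrix (Fin 2) (Fin 2) ℂ) : Submodule ℂ V :=
  LinearMap.ker (tail - M.mulVecLin ∘ₗ head)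

theorem mem_graphLine {M : Matrix (Fin 2) (Fin 2) ℂ} {x : V} :
    x ∈ graphLine M ↔ tail x = M.mulVec (head x) := by
  rw [graphLine, LinearMap.mem_ker, LinearMap.sub_apply, sub_eq_zero]
  rfl

/-- The line that joins the point `a` of the axis `x₂ = x₃ = 0` to the point `b` of the axis
`x₀ = x₁ = 0`. -/
def crossLine (a b : Fin 2 → ℂ) : Submodule ℂ V :=
  (ℂ ∙ a).comap head ⊓ (ℂ ∙ b).comap tail

theorem mem_crossLine {a b : Fin 2 → ℂ} {x : V} :
    x ∈ crossLine a b ↔ (∃ s : ℂ, s • a = head x) ∧ ∃ t : ℂ, t • b = tail x := by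
  simp [crossLine, Submodule.mem_span_singleton]

theorem finrank_graphLine (M : Matrix (Fin 2) (Fin 2) ℂ) :
    Module.finrank ℂ (graphLine M) = 2 := by
  have hb : Function.Bijective (head.domRestrict (graphLine M)) := by
    constructor
    · rintro ⟨x, hx⟩ ⟨y, hy⟩ h
      have h' : head x = head y := h
      refine Subtype.ext (ext_head_tail h' ?_)
      rw [mem_graphLine.1 hx, mem_graphLine.1 hy, h']
    · intro v
      exact ⟨⟨join v (M.mulVec v), mem_graphLine.2 (by simp)⟩, head_join _ _⟩
  simpa using (LinearEquiv.ofBijective _ hb).finrank_eq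

theorem finrank_crossLine {a b : Fin 2 → ℂ} (ha : a ≠ 0) (hb : b ≠ 0) :
    Module.finrank ℂ (crossLine a b) = 2 := by
  have hspan : crossLine a b = Submodule.span ℂ (Set.range ![join a 0, join 0 b]) := by
    ext x
    rw [mem_crossLine, Matrix.range_cons, Matrix.range_cons, Matrix.range_empty, Set.union_empty,
      Set.singleton_union, Submodule.mem_span_pair]
    constructor
    · rintro ⟨⟨s, hs⟩, t, ht⟩
      exact ⟨s, t, ext_head_tail (by simp [hs]) (by simp [ht])⟩
    · rintro ⟨s, t, rfl⟩
      exact ⟨⟨s, by simp⟩, t, by simp⟩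
  have hli : LinearIndependent ℂ ![join a 0, join 0 b] := by
    rw [LinearIndependent.pair_iff]
    intro s t h
    have h1 := congrArg head h
    have h2 := congrArg tail h
    simp [ha, hb] at h1 h2
    exact ⟨h1, h2⟩
  rw [hspan, finrank_span_eq_card hli, Fintype.card_fin]

theorem graphLine_injective : Function.Injective graphLine := by
  intro M N h
  have key : ∀ v, M.mulVec v = N.mulVec v := by
    intro v
    have : join v (M.mulVec v) ∈ graphLine N := h ▸ mem_graphLine.2 (by simp)
    simpa using mem_graphLine.1 this
  exact Matrix.ext_of_mulVec_single fun i => key _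

theorem graphLine_mem_linesOn {M : Matrix (Fin 2) (Fin 2) ℂ} (hM : M ∈ quarticSymmetries) :
    graphLine M ∈ linesOn schurQuartic := by
  refine ⟨finrank_graphLine M, fun x hx => ?_⟩
  rw [eval_schurQuartic, mem_graphLine.1 hx, hM, sub_self]

theorem graphLine_inf_axisB (M : Matrix (Fin 2) (Fin 2) ℂ) : graphLine M ⊓ axisB = ⊥ := by
  rw [eq_bot_iff]
  rintro x ⟨hx, hx'⟩
  have h := mem_axisB.1 hx'
  have h' := mem_graphLine.1 hx
  rw [h, Matrix.mulVec_zero] at h'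
  exact ext_head_tail (by simp [h]) (by simp [h'])

/-- A line that misses this axis projects isomorphically to the first two coordinates; the inverse
followed by the projection to the last two is the required map. -/
theorem exists_graphLine_eq {L : Submodule ℂ V} (hL : L ∈ linesOn schurQuartic)
    (h : L ⊓ axisB = ⊥) : ∃ M ∈ quarticSymmetries, graphLine M = L := by
  have hinj : Function.Injective (head.domRestrict L) := by
    rw [← LinearMap.ker_eq_bot, eq_bot_iff]
    rintro ⟨x, hx⟩ hx'
    have : x ∈ L ⊓ axisB := ⟨hx, mem_axisB.2 hx'⟩
    rw [h, Submodule.mem_bot] at this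
    exact Subtype.ext this
  have hsurj : Function.Surjective (head.domRestrict L) :=
    (LinearMap.injective_iff_surjective_of_finrank_eq_finrank (by simp [hL.1])).1 hinj
  let e := LinearEquiv.ofBijective (head.domRestrict L) ⟨hinj, hsurj⟩
  let f : (Fin 2 → ℂ) →ₗ[ℂ] (Fin 2 → ℂ) := tail ∘ₗ L.subtype ∘ₗ e.symm.toLinearMap
  have hf : ∀ x ∈ L, tail x = (LinearMap.toMatrix' f).mulVec (head x) := by
    intro x hx
    have : e.symm (head x) = ⟨x, hx⟩ := by rw [LinearEquiv.symm_apply_eq]; rfl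
    rw [LinearMap.toMatrix'_mulVec]
    simp [f, this]
  have hle : L ≤ graphLine (LinearMap.toMatrix' f) := fun x hx => mem_graphLine.2 (hf x hx)
  have heq := Submodule.eq_of_le_of_finrank_eq hle (by rw [hL.1, finrank_graphLine])
  refine ⟨LinearMap.toMatrix' f, fun v => ?_, heq.symm⟩
  have hv : join v ((LinearMap.toMatrix' f).mulVec v) ∈ L := by
    rw [heq]; exact mem_graphLine.2 (by simp)
  have := hL.2 _ hv
  rw [eval_schurQuartic, head_join, tail_join] at this
  exact (sub_eq_zero.1 this).symm

/-- Let x in L lie on the second axis and y complete it to a basis of L. The form is constant along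
tail y + t · tail x, so its derivative at tail x in the direction tail y vanishes. Since tail x is a
simple zero of the form, tail y is a multiple c · tail x, and y - cx lies on the first axis. -/
theorem inf_axisA_ne_bot {L : Submodule ℂ V} (hL : L ∈ linesOn schurQuartic)
    (h : L ⊓ axisB ≠ ⊥) : L ⊓ axisA ≠ ⊥ := by
  obtain ⟨x, ⟨hxL, hxB⟩, hx0⟩ := (Submodule.ne_bot_iff _).1 h
  have hhx := mem_axisB.1 hxB
  obtain ⟨y, hyL, hy⟩ : ∃ y ∈ L, y ∉ ℂ ∙ x := by
    by_contra! hcon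
    have h1 : Module.finrank ℂ L ≤ Module.finrank ℂ (ℂ ∙ x) := Submodule.finrank_mono hcon
    rw [hL.1, finrank_span_singleton hx0] at h1
    omega
  have key : ∀ t : ℂ, binaryQuartic (head y) = binaryQuartic (tail y + t • tail x) := by
    intro t
    have := hL.2 _ (L.add_mem hyL (L.smul_mem t hxL))
    rw [eval_schurQuartic] at this
    simpa [hhx] using sub_eq_zero.1 this
  have h0 := hL.2 _ hxL
  rw [eval_schurQuartic, hhx] at h0
  have k0 := key 0
  have k1 := key 1
  have k2 := key (-1)
  have k3 := key 2
  simp only [binaryQuartic, tail_apply, Pi.add_apply, Pi.smul_apply, Matrix.cons_val_zero,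
    Matrix.cons_val_one, smul_eq_mul, Pi.zero_apply] at h0 k0 k1 k2 k3
  -- This is the coefficient of t³, isolated by interpolation at t = 0, 1, -1, 2; the coefficient of
  -- t⁴ vanishes by `h0`.
  have hcub : 4 * x 2 ^ 3 * y 2 - y 2 * x 3 ^ 3 - 3 * x 2 * x 3 ^ 2 * y 3 = 0 := by
    linear_combination 2 * h0 + (1 / 2) * (k1 - k0) + (1 / 6) * (k2 - k0) - (1 / 6) * (k3 - k0)
  have hprop : ∃ c : ℂ, tail y = c • tail x := by
    by_cases hx2 : x 2 = 0
    · have hx3 : x 3 ≠ 0 := by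
        intro hx3
        exact hx0 (ext_head_tail (by simp [hhx]) (by simp [tail_apply, hx2, hx3]))
      have hy2 : y 2 = 0 := by simpa [hx2, hx3] using hcub
      refine ⟨y 3 / x 3, ?_⟩
      ext i
      fin_cases i
      · simp [tail_apply, hx2, hy2]
      · simp [tail_apply]; field_simp
    · have h3 : x 3 ^ 3 = x 2 ^ 3 := by
        apply mul_left_cancel₀ hx2
        linear_combination h0
      have hx3 : x 3 ≠ 0 := by
        intro hx3; rw [hx3] at h3; exact hx2 (by simpa using h3.symm)
      have hd : x 3 * y 2 = x 2 * y 3 := by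
        apply mul_left_cancel₀ (mul_ne_zero three_ne_zero (pow_ne_zero 2 hx3))
        linear_combination hcub + 4 * y 2 * h3
      refine ⟨y 2 / x 2, ?_⟩
      ext i
      fin_cases i
      · simp [tail_apply]; field_simp
      · simp [tail_apply]; field_simp; linear_combination -hd
  obtain ⟨c, hc⟩ := hprop
  rw [Submodule.ne_bot_iff]
  refine ⟨y - c • x, ⟨L.sub_mem hyL (L.smul_mem c hxL), mem_axisA.2 (by simp [hc])⟩, fun h0 => ?_⟩
  exact hy (Submodule.mem_span_singleton.2 ⟨c, (sub_eq_zero.1 h0).symm⟩)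

theorem secondKind_eq : secondKind = graphLine '' quarticSymmetries := by
  ext L
  constructor
  · rintro ⟨hL, hL'⟩
    refine exists_graphLine_eq hL ?_
    by_contra h
    exact hL' ⟨hL, inf_axisA_ne_bot hL h, h⟩
  · rintro ⟨M, hM, rfl⟩
    exact ⟨graphLine_mem_linesOn hM, fun h => h.2.2 (graphLine_inf_axisB M)⟩

theorem crossLine_mem_firstKind {a b : Fin 2 → ℂ} (ha : a ∈ quarticZeros)
    (hb : b ∈ quarticZeros) : crossLine a b ∈ firstKind := by
  have ha0 := ne_zero_of_mem_quarticZeros ha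
  have hb0 := ne_zero_of_mem_quarticZeros hb
  refine ⟨⟨finrank_crossLine ha0 hb0, fun x hx => ?_⟩, ?_, ?_⟩
  · obtain ⟨⟨s, hs⟩, t, ht⟩ := mem_crossLine.1 hx
    rw [eval_schurQuartic, ← hs, ← ht, binaryQuartic_smul, binaryQuartic_smul,
      binaryQuartic_of_mem_quarticZeros ha, binaryQuartic_of_mem_quarticZeros hb]
    simp
  · rw [Submodule.ne_bot_iff]
    exact ⟨join a 0, ⟨mem_crossLine.2 ⟨⟨1, by simp⟩, 0, by simp⟩, mem_axisA.2 (by simp)⟩,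
      fun h => ha0 (by simpa using congrArg head h)⟩
  · rw [Submodule.ne_bot_iff]
    exact ⟨join 0 b, ⟨mem_crossLine.2 ⟨⟨0, by simp⟩, 1, by simp⟩, mem_axisB.2 (by simp)⟩,
      fun h => hb0 (by simpa using congrArg tail h)⟩

theorem firstKind_eq : firstKind =
    (fun q : (Fin 2 → ℂ) × (Fin 2 → ℂ) => crossLine q.1 q.2) '' (quarticZeros ×ˢ quarticZeros) := by
  ext L
  constructor
  · rintro ⟨hL, hA, hB⟩
    obtain ⟨x, ⟨hxL, hxA⟩, hx0⟩ := (Submodule.ne_bot_iff _).1 hA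
    obtain ⟨y, ⟨hyL, hyB⟩, hy0⟩ := (Submodule.ne_bot_iff _).1 hB
    have htx := mem_axisA.1 hxA
    have hhy := mem_axisB.1 hyB
    have hx : head x ≠ 0 := fun h => hx0 (ext_head_tail (by simp [h]) (by simp [htx]))
    have hy : tail y ≠ 0 := fun h => hy0 (ext_head_tail (by simp [hhy]) (by simp [h]))
    have ex := hL.2 x hxL
    have ey := hL.2 y hyL
    rw [eval_schurQuartic, htx] at ex
    rw [eval_schurQuartic, hhy] at ey
    obtain ⟨a, ha, s, hs, hsa⟩ := exists_mem_quarticZeros hx (by simpa using ex)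
    obtain ⟨b, hb, t, ht, htb⟩ := exists_mem_quarticZeros hy (by simpa using ey)
    refine ⟨(a, b), ⟨ha, hb⟩, Submodule.eq_of_le_of_finrank_eq (fun z hz => ?_) ?_⟩
    · obtain ⟨⟨p, hp⟩, q, hq⟩ := mem_crossLine.1 hz
      have : z = (p / s) • x + (q / t) • y := by
        refine ext_head_tail ?_ ?_
        · simp only at hp
          simp [hhy, hsa, ← hp, smul_smul, hs]
        · simp only at hq
          simp [htx, htb, ← hq, smul_smul, ht]
      rw [this]
      exact L.add_mem (L.smul_mem _ hxL) (L.smul_mem _ hyL)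
    · rw [hL.1]
      exact finrank_crossLine (ne_zero_of_mem_quarticZeros ha) (ne_zero_of_mem_quarticZeros hb)
  · rintro ⟨⟨a, b⟩, ⟨ha, hb⟩, rfl⟩
    exact crossLine_mem_firstKind ha hb

theorem eq_of_smul_eq_smul {a b : Fin 2 → ℂ} (ha : a ∈ quarticZeros) (hb : b ∈ quarticZeros)
    {s t : ℂ} (hs : s ≠ 0) (h : s • a = t • b) : a = b := by
  refine eq_of_mem_quarticZeros ha hb (mul_left_cancel₀ hs ?_)
  have h0 := congrFun h 0
  have h1 := congrFun h 1
  simp only [Pi.smul_apply, smul_eq_mul] at h0 h1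
  linear_combination b 1 * h0 - b 0 * h1

theorem crossLine_injOn : Set.InjOn (fun q : (Fin 2 → ℂ) × (Fin 2 → ℂ) => crossLine q.1 q.2)
    (quarticZeros ×ˢ quarticZeros) := by
  rintro ⟨a, b⟩ ⟨ha, hb⟩ ⟨a', b'⟩ ⟨ha', hb'⟩ h
  have h : crossLine a b = crossLine a' b' := h
  have hx : join a b ∈ crossLine a b := mem_crossLine.2 ⟨⟨1, by simp⟩, 1, by simp⟩
  rw [h, mem_crossLine, head_join, tail_join] at hx
  obtain ⟨⟨s, hs⟩, t, ht⟩ := hx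
  exact Prod.ext (eq_of_smul_eq_smul ha ha' one_ne_zero (t := s) (by simp [hs]))
    (eq_of_smul_eq_smul hb hb' one_ne_zero (t := t) (by simp [ht]))

theorem ncard_firstKind : firstKind.ncard = 16 := by
  rw [firstKind_eq, crossLine_injOn.ncard_image, Set.ncard_prod, ncard_quarticZeros]

theorem ncard_secondKind : secondKind.ncard = 48 := by
  rw [secondKind_eq, Set.ncard_image_of_injective _ graphLine_injective, ncard_quarticSymmetries]

theorem finite_firstKind : firstKind.Finite :=
  Set.finite_of_ncard_ne_zero (by rw [ncard_firstKind]; norm_num)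

theorem finite_secondKind : secondKind.Finite :=
  Set.finite_of_ncard_ne_zero (by rw [ncard_secondKind]; norm_num)

theorem linesOn_eq : linesOn schurQuartic = firstKind ∪ secondKind :=
  (Set.union_sdiff_cancel fun _ h => h.1).symm

theorem disjoint_firstKind_secondKind : Disjoint firstKind secondKind :=
  Set.disjoint_sdiff_right

theorem finite_linesOn : (linesOn schurQuartic).Finite := by
  rw [linesOn_eq]
  exact finite_firstKind.union finite_secondKind

theorem ncard_linesOn : (linesOn schurQuartic).ncard = 64 := by
  rw [linesOn_eq, Set.ncard_union_eq disjoint_firstKind_secondKind finite_firstKind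
    finite_secondKind, ncard_firstKind, ncard_secondKind]

/-! ### Smoothness and tangent planes -/

theorem eval_pderiv_schurQuartic (v : V) :
    eval v (pderiv 0 schurQuartic) = 4 * v 0 ^ 3 - v 1 ^ 3 ∧
    eval v (pderiv 1 schurQuartic) = -(3 * v 0 * v 1 ^ 2) ∧
    eval v (pderiv 2 schurQuartic) = -(4 * v 2 ^ 3) + v 3 ^ 3 ∧
    eval v (pderiv 3 schurQuartic) = 3 * v 2 * v 3 ^ 2 := by
  refine ⟨?_, ?_, ?_, ?_⟩ <;>
  simp [schurQuartic, pderiv_X] <;> ring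

theorem isSmoothQuartic_schurQuartic : IsSmoothQuartic schurQuartic := by
  refine ⟨?_, ?_, ?_⟩
  · intro h
    have := congrArg (eval ![1, 0, 0, 0]) h
    simp [schurQuartic] at this
  · have h (i : Fin 4) : (X i : MvPolynomial (Fin 4) ℂ).IsHomogeneous 1 := isHomogeneous_X _ _
    exact ((((h 0).pow 4).sub ((h 0).mul ((h 1).pow 3))).sub ((h 2).pow 4)).add
      ((h 2).mul ((h 3).pow 3))
  · intro v hv _
    by_contra! hcon
    obtain ⟨e0, e1, e2, e3⟩ := eval_pderiv_schurQuartic v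
    rw [hcon] at e0 e1 e2 e3
    have h01 : v 0 = 0 ∧ v 1 = 0 := by
      have : v 0 * v 1 ^ 2 = 0 := by linear_combination e1 / 3
      rcases mul_eq_zero.1 this with h | h
      · refine ⟨h, ?_⟩
        simpa [h] using e0
      · have h1 : v 1 = 0 := by simpa using h
        refine ⟨?_, h1⟩
        simpa [h1] using e0
    have h23 : v 2 = 0 ∧ v 3 = 0 := by
      have : v 2 * v 3 ^ 2 = 0 := by linear_combination -e3 / 3
      rcases mul_eq_zero.1 this with h | h
      · refine ⟨h, ?_⟩
        simpa [h] using e2.symm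
      · have h1 : v 3 = 0 := by simpa using h
        refine ⟨?_, h1⟩
        simpa [h1] using e2
    apply hv
    ext i
    fin_cases i
    · exact h01.1
    · exact h01.2
    · exact h23.1
    · exact h23.2

theorem le_tangentSpace {L : Submodule ℂ V} (hL : L ∈ linesOn schurQuartic) {v : V} (hv : v ∈ L) :
    L ≤ tangentSpace schurQuartic v := by
  intro u hu
  obtain ⟨e0, e1, e2, e3⟩ := eval_pderiv_schurQuartic v
  have key : ∀ c : ℂ, eval (v + c • u) schurQuartic = 0 := fun c =>
    hL.2 _ (L.add_mem hv (L.smul_mem c hu))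
  have k1 := key 1
  have k2 := key (-1)
  have k3 := key 2
  have k4 := key (-2)
  simp only [eval_schurQuartic, binaryQuartic, head_apply, tail_apply, Pi.add_apply,
    Pi.smul_apply, smul_eq_mul, Matrix.cons_val_zero, Matrix.cons_val_one] at k1 k2 k3 k4
  rw [tangentSpace, LinearMap.mem_ker]
  simp only [Fin.sum_univ_four, e0, e1, e2, e3, LinearMap.add_apply, LinearMap.smul_apply,
    LinearMap.proj_apply, smul_eq_mul]
  -- The central difference formula with steps 1 and 2, which computes the derivative at 0 exactly
  -- for polynomials of degree at most four.
  linear_combination (2 / 3) * (k1 - k2) - (1 / 12) * (k3 - k4)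

theorem finrank_tangentSpace_le {v : V} (hv : v ≠ 0) (h : eval v schurQuartic = 0) :
    Module.finrank ℂ (tangentSpace schurQuartic v) ≤ 3 := by
  obtain ⟨i, hi⟩ := isSmoothQuartic_schurQuartic.2.2 v hv h
  have hne : tangentSpace schurQuartic v ≠ ⊤ := by
    intro htop
    have : Pi.single i 1 ∈ tangentSpace schurQuartic v := htop ▸ Submodule.mem_top
    rw [tangentSpace, LinearMap.mem_ker] at this
    simp [Pi.single_apply] at this
    exact hi this
  have := Submodule.finrank_lt hne
  simp at this
  omega

theorem finrank_inf_le_one {L M : Submodule ℂ V} (hL : Module.finrank ℂ L = 2)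
    (hM : Module.finrank ℂ M = 2) (hne : L ≠ M) : Module.finrank ℂ ↥(L ⊓ M) ≤ 1 := by
  by_contra! h
  have h1 : L ⊓ M = L :=
    Submodule.eq_of_le_of_finrank_le inf_le_left (by omega)
  have h2 : L ⊓ M = M :=
    Submodule.eq_of_le_of_finrank_le inf_le_right (by omega)
  exact hne (h1.symm.trans h2)

/-- Both lines lie in the tangent space, which has dimension at most 3 by smoothness, while two
distinct lines with a common point already span dimension 3. -/
theorem sup_eq_tangentSpace {L M : Submodule ℂ V} (hL : L ∈ linesOn schurQuartic)
    (hM : M ∈ linesOn schurQuartic) (hne : L ≠ M) {v : V} (hv : v ∈ L ⊓ M) (hv0 : v ≠ 0) :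
    L ⊔ M = tangentSpace schurQuartic v := by
  refine Submodule.eq_of_le_of_finrank_le
    (sup_le (le_tangentSpace hL hv.1) (le_tangentSpace hM hv.2)) ?_
  have h1 := Submodule.finrank_sup_add_finrank_inf_eq L M
  have h2 := finrank_inf_le_one hL.1 hM.1 hne
  have h3 := finrank_tangentSpace_le hv0 (hL.2 v hv.1)
  rw [hL.1, hM.1] at h1
  omega

/-! ### Multiplicities of points -/

theorem submodule_mk_le {x : V} (hx : x ≠ 0) {L : Submodule ℂ V} :
    (Projectivization.mk ℂ x hx).submodule ≤ L ↔ x ∈ L := by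
  rw [Projectivization.submodule_mk, Submodule.span_singleton_le_iff_mem]

theorem multiplicity_mk (C : Set (Submodule ℂ V)) {x : V} (hx : x ≠ 0) :
    multiplicity C (Projectivization.mk ℂ x hx) = {L ∈ C | x ∈ L}.ncard := by
  simp only [multiplicity, submodule_mk_le]

theorem multiplicity_le_ncard {C : Set (Submodule ℂ V)} (hC : C.Finite) (p : P3) :
    multiplicity C p ≤ C.ncard :=
  Set.ncard_le_ncard (fun _ h => h.1) hC

theorem multiplicity_mono {C D : Set (Submodule ℂ V)} (h : C ⊆ D) (hD : D.Finite) (p : P3) :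
    multiplicity C p ≤ multiplicity D p :=
  Set.ncard_le_ncard (fun _ h' => ⟨h h'.1, h'.2⟩) (hD.subset fun _ h => h.1)

theorem multiplicity_union {C D : Set (Submodule ℂ V)} (hC : C.Finite) (hD : D.Finite)
    (h : Disjoint C D) (p : P3) :
    multiplicity (C ∪ D) p = multiplicity C p + multiplicity D p := by
  rw [multiplicity, multiplicity, multiplicity, ← Set.ncard_union_eq _
    (hC.subset fun _ h => h.1) (hD.subset fun _ h => h.1)]
  · congr 1
    ext L
    simp [or_and_right]
  · exact h.mono (fun _ h => h.1) (fun _ h => h.1)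

theorem one_le_multiplicity {C : Set (Submodule ℂ V)} (hC : C.Finite) {p : P3}
    {L : Submodule ℂ V} (hL : L ∈ C) (hp : p.submodule ≤ L) : 1 ≤ multiplicity C p :=
  (Set.ncard_pos (hC.subset fun _ h => h.1)).2 ⟨L, hL, hp⟩

theorem exists_of_one_le_multiplicity {C : Set (Submodule ℂ V)} {p : P3}
    (h : 1 ≤ multiplicity C p) : ∃ L ∈ C, p.submodule ≤ L := by
  obtain ⟨L, hL⟩ := Set.nonempty_of_ncard_ne_zero (Nat.one_le_iff_ne_zero.1 h)
  exact ⟨L, hL.1, hL.2⟩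

/-- Such a point lies on two distinct lines of a finite set, and each pair has at most one common
point. Finiteness matters because `Set.ncard` is 0 on infinite sets. -/
theorem finite_setOf_two_le_multiplicity {C : Set (Submodule ℂ V)}
    (hC : C ⊆ linesOn schurQuartic) : {p | 2 ≤ multiplicity C p}.Finite := by
  have hfin := finite_linesOn.subset hC
  refine (hfin.biUnion fun L hL => (hfin.biUnion fun M hM => ?_ :
    (⋃ M ∈ C, {p : P3 | L ≠ M ∧ p.submodule ≤ L ⊓ M}).Finite)).subset fun p hp => ?_
  · refine Set.Subsingleton.finite ?_
    rintro p ⟨hne, hp⟩ q ⟨-, hq⟩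
    have h1 := finrank_inf_le_one (hC hL).1 (hC hM).1 hne
    apply Projectivization.submodule_injective
    rw [Submodule.eq_of_le_of_finrank_le hp (by rwa [Projectivization.finrank_submodule]),
      Submodule.eq_of_le_of_finrank_le hq (by rwa [Projectivization.finrank_submodule])]
  · obtain ⟨L, hL, M, hM, hne⟩ := (Set.one_lt_ncard (hfin.subset fun _ h => h.1)).1 hp
    simp only [Set.mem_iUnion]
    exact ⟨L, hL.1, M, hM.1, hne, le_inf hL.2 hM.2⟩

theorem head_ne_zero {M : Matrix (Fin 2) (Fin 2) ℂ} {x : V} (hx : x ≠ 0)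
    (hM : x ∈ graphLine M) : head x ≠ 0 := by
  intro h
  rw [mem_graphLine, h, Matrix.mulVec_zero] at hM
  exact hx (ext_head_tail (by simp [h]) (by simp [hM]))

theorem tail_ne_zero {M : Matrix (Fin 2) (Fin 2) ℂ} (hM : M ∈ quarticSymmetries) {x : V}
    (hx : x ≠ 0) (hxM : x ∈ graphLine M) : tail x ≠ 0 := by
  intro h
  rw [mem_graphLine] at hxM
  have := congrArg (M⁻¹.mulVec) hxM
  rw [Matrix.mulVec_mulVec, Matrix.nonsing_inv_mul _ (isUnit_det_of_mem hM), Matrix.one_mulVec,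
    h, Matrix.mulVec_zero] at this
  exact hx (ext_head_tail (by simp [← this]) (by simp [h]))

theorem multiplicity_secondKind_mk {M : Matrix (Fin 2) (Fin 2) ℂ} (hM : M ∈ quarticSymmetries)
    {x : V} (hx : x ≠ 0) (hxM : x ∈ graphLine M) :
    multiplicity secondKind (Projectivization.mk ℂ x hx) = (fixer (head x)).ncard := by
  rw [multiplicity_mk, ← ncard_setOf_mulVec_eq hM, ← Set.ncard_image_of_injective _
    graphLine_injective]
  congr 1
  rw [secondKind_eq]
  ext L
  constructor
  · rintro ⟨⟨N, hN, rfl⟩, hx⟩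
    exact ⟨N, ⟨hN, by rw [← mem_graphLine.1 hx, ← mem_graphLine.1 hxM]⟩, rfl⟩
  · rintro ⟨N, ⟨hN, h⟩, rfl⟩
    exact ⟨⟨N, hN, rfl⟩, mem_graphLine.2 (by rw [h, ← mem_graphLine.1 hxM])⟩

theorem multiplicity_secondKind_le (p : P3) : multiplicity secondKind p ≤ 3 := by
  by_contra! h
  obtain ⟨L, hL, hp⟩ := exists_of_one_le_multiplicity (C := secondKind) (p := p) (by omega)
  rw [secondKind_eq] at hL
  obtain ⟨M, hM, rfl⟩ := hL
  induction p using Projectivization.ind with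
  | h x hx =>
    rw [submodule_mk_le] at hp
    rw [multiplicity_secondKind_mk hM hx hp] at h
    have := ncard_fixer_le (head_ne_zero hx hp)
    omega

theorem one_vec_ne_zero (y : ℂ) : (![1, y] : Fin 2 → ℂ) ≠ 0 := fun h => by
  simpa using congrFun h 0

theorem join_ne_zero_left {v : Fin 2 → ℂ} (hv : v ≠ 0) (w : Fin 2 → ℂ) : join v w ≠ 0 :=
  fun h => hv (by simpa using congrArg head h)

theorem join_ne_zero_right (v : Fin 2 → ℂ) {w : Fin 2 → ℂ} (hw : w ≠ 0) : join v w ≠ 0 :=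
  fun h => hw (by simpa using congrArg tail h)

theorem join_mulVec_mem_graphLine (M : Matrix (Fin 2) (Fin 2) ℂ) (v : Fin 2 → ℂ) :
    join v (M.mulVec v) ∈ graphLine M := mem_graphLine.2 (by simp)

/-- The points of the graph are parametrized by the projective line. The chart (1, y) omits only the
direction (0, 1), whose stabilizer is trivial; this is why k = 1 is excluded. -/
theorem ncard_setOf_multiplicity_eq {M : Matrix (Fin 2) (Fin 2) ℂ} (hM : M ∈ quarticSymmetries)
    {k : ℕ} (hk : k ≠ 1) :
    {p : P3 | p.submodule ≤ graphLine M ∧ multiplicity secondKind p = k}.ncard =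
      {y : ℂ | (fixer ![1, y]).ncard = k}.ncard := by
  have himage : {p : P3 | p.submodule ≤ graphLine M ∧ multiplicity secondKind p = k} =
      (fun y : ℂ => Projectivization.mk ℂ (join ![1, y] (M.mulVec ![1, y]))
        (join_ne_zero_left (one_vec_ne_zero y) _)) '' {y : ℂ | (fixer ![1, y]).ncard = k} := by
    ext p
    constructor
    · rintro ⟨hp, hpk⟩
      induction p using Projectivization.ind with
      | h x hx =>
        rw [submodule_mk_le] at hp
        rw [multiplicity_secondKind_mk hM hx hp] at hpk
        obtain ⟨s, hs, h | ⟨y, h⟩⟩ := exists_smul_eq (head_ne_zero hx hp)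
        · rw [h, fixer_smul hs, fixer_zero_one] at hpk
          exact absurd hpk.symm hk
        · rw [h, fixer_smul hs] at hpk
          refine ⟨y, hpk, ?_⟩
          rw [Projectivization.mk_eq_mk_iff']
          refine ⟨s⁻¹, ext_head_tail ?_ ?_⟩
          · simp [h, hs]
          · rw [map_smul, mem_graphLine.1 hp, h, Matrix.mulVec_smul, smul_smul,
              inv_mul_cancel₀ hs, one_smul, tail_join]
    · rintro ⟨y, hy, rfl⟩
      refine ⟨(submodule_mk_le _).2 (join_mulVec_mem_graphLine M _), ?_⟩
      rw [multiplicity_secondKind_mk hM _ (join_mulVec_mem_graphLine M _), head_join]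
      exact hy
  rw [himage, Set.ncard_image_of_injective]
  intro y y' h
  obtain ⟨s, hs⟩ := (Projectivization.mk_eq_mk_iff' _ _ _ _ _).1 h
  have h1 := congrArg head hs
  rw [map_smul, head_join, head_join] at h1
  have e0 := congrFun h1 0
  have e1 := congrFun h1 1
  simp at e0 e1
  rw [← e1, e0, one_mul]

theorem ncard_double_points {L : Submodule ℂ V} (hL : L ∈ secondKind) :
    {p : P3 | p.submodule ≤ L ∧ multiplicity secondKind p = 2}.ncard = 6 := by
  rw [secondKind_eq] at hL
  obtain ⟨M, hM, rfl⟩ := hL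
  rw [ncard_setOf_multiplicity_eq hM (by norm_num)]
  simp only [ncard_fixer_one_eq_two_iff, ncard_setOf_double]

theorem ncard_triple_points {L : Submodule ℂ V} (hL : L ∈ secondKind) :
    {p : P3 | p.submodule ≤ L ∧ multiplicity secondKind p = 3}.ncard = 4 := by
  rw [secondKind_eq] at hL
  obtain ⟨M, hM, rfl⟩ := hL
  rw [ncard_setOf_multiplicity_eq hM (by norm_num)]
  simp only [ncard_fixer_one_eq_three_iff, ncard_setOf_triple]

/-! ### Points on lines of the first kind, and mixed points -/

theorem mem_firstKind {L : Submodule ℂ V} :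
    L ∈ firstKind ↔ ∃ a ∈ quarticZeros, ∃ b ∈ quarticZeros, L = crossLine a b := by
  rw [firstKind_eq]
  constructor
  · rintro ⟨⟨a, b⟩, ⟨ha, hb⟩, rfl⟩
    exact ⟨a, ha, b, hb, rfl⟩
  · rintro ⟨a, ha, b, hb, rfl⟩
    exact ⟨(a, b), ⟨ha, hb⟩, rfl⟩

theorem eq_left_of_mem_crossLine {a b a' b' : Fin 2 → ℂ} (ha : a ∈ quarticZeros)
    (ha' : a' ∈ quarticZeros) {x : V} (h : x ∈ crossLine a b) (h' : x ∈ crossLine a' b')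
    (hx : head x ≠ 0) : a = a' := by
  obtain ⟨⟨s, hs⟩, -⟩ := mem_crossLine.1 h
  obtain ⟨⟨s', hs'⟩, -⟩ := mem_crossLine.1 h'
  refine eq_of_smul_eq_smul ha ha' (s := s) (t := s') ?_ (hs.trans hs'.symm)
  rintro rfl
  exact hx (by simp [← hs])

theorem eq_right_of_mem_crossLine {a b a' b' : Fin 2 → ℂ} (hb : b ∈ quarticZeros)
    (hb' : b' ∈ quarticZeros) {x : V} (h : x ∈ crossLine a b) (h' : x ∈ crossLine a' b')
    (hx : tail x ≠ 0) : b = b' := by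
  obtain ⟨-, ⟨s, hs⟩⟩ := mem_crossLine.1 h
  obtain ⟨-, ⟨s', hs'⟩⟩ := mem_crossLine.1 h'
  refine eq_of_smul_eq_smul hb hb' (s := s) (t := s') ?_ (hs.trans hs'.symm)
  rintro rfl
  exact hx (by simp [← hs])

theorem multiplicity_firstKind_eq_one {a b : Fin 2 → ℂ} (ha : a ∈ quarticZeros)
    (hb : b ∈ quarticZeros) {x : V} (hx : x ≠ 0) (h : x ∈ crossLine a b) (hh : head x ≠ 0)
    (ht : tail x ≠ 0) : multiplicity firstKind (Projectivization.mk ℂ x hx) = 1 := by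
  rw [multiplicity_mk, Set.ncard_eq_one]
  refine ⟨crossLine a b, ?_⟩
  ext L
  constructor
  · rintro ⟨hL, hxL⟩
    obtain ⟨a', ha', b', hb', rfl⟩ := mem_firstKind.1 hL
    rw [Set.mem_singleton_iff, eq_left_of_mem_crossLine ha ha' h hxL hh,
      eq_right_of_mem_crossLine hb hb' h hxL ht]
  · rintro rfl
    exact ⟨crossLine_mem_firstKind ha hb, h⟩

theorem multiplicity_firstKind_le (p : P3) : multiplicity firstKind p ≤ 4 := by
  induction p using Projectivization.ind with
  | h x hx =>
    rw [multiplicity_mk]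
    rcases Set.eq_empty_or_nonempty {L ∈ firstKind | x ∈ L} with h | ⟨L, hL, hxL⟩
    · simp [h]
    obtain ⟨a, ha, b, hb, rfl⟩ := mem_firstKind.1 hL
    by_cases hh : head x = 0
    · have ht : tail x ≠ 0 := fun ht => hx (ext_head_tail (by simp [hh]) (by simp [ht]))
      have hsub : {L ∈ firstKind | x ∈ L} ⊆ (fun a' => crossLine a' b) '' quarticZeros := by
        rintro L' ⟨hL', hxL'⟩
        obtain ⟨a', ha', b', hb', rfl⟩ := mem_firstKind.1 hL'
        exact ⟨a', ha', by rw [eq_right_of_mem_crossLine hb hb' hxL hxL' ht]⟩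
      exact (Set.ncard_le_ncard hsub (finite_quarticZeros.image _)).trans
        ((Set.ncard_image_le finite_quarticZeros).trans ncard_quarticZeros.le)
    · have hsub : {L ∈ firstKind | x ∈ L} ⊆ (fun b' => crossLine a b') '' quarticZeros := by
        rintro L' ⟨hL', hxL'⟩
        obtain ⟨a', ha', b', hb', rfl⟩ := mem_firstKind.1 hL'
        exact ⟨b', hb', by rw [eq_left_of_mem_crossLine ha ha' hxL hxL' hh]⟩
      exact (Set.ncard_le_ncard hsub (finite_quarticZeros.image _)).trans
        ((Set.ncard_image_le finite_quarticZeros).trans ncard_quarticZeros.le)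

/-- A point on lines of both kinds lies off the axes, so its two projections determine the line of
the first kind. Its head is a zero of the quartic and hence has trivial stabilizer, so the line of
the second kind is unique as well. -/
theorem multiplicity_eq_one_of_mixed {p : P3} (h1 : 1 ≤ multiplicity firstKind p)
    (h2 : 1 ≤ multiplicity secondKind p) :
    multiplicity firstKind p = 1 ∧ multiplicity secondKind p = 1 := by
  obtain ⟨L, hL, hpL⟩ := exists_of_one_le_multiplicity h1
  obtain ⟨K, hK, hpK⟩ := exists_of_one_le_multiplicity h2
  obtain ⟨a, ha, b, hb, rfl⟩ := mem_firstKind.1 hL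
  rw [secondKind_eq] at hK
  obtain ⟨M, hM, rfl⟩ := hK
  induction p using Projectivization.ind with
  | h x hx =>
    rw [submodule_mk_le] at hpL hpK
    have hh := head_ne_zero hx hpK
    refine ⟨multiplicity_firstKind_eq_one ha hb hx hpL hh (tail_ne_zero hM hx hpK), ?_⟩
    rw [multiplicity_secondKind_mk hM hx hpK]
    refine ncard_fixer_eq_one hh ?_
    obtain ⟨⟨s, hs⟩, -⟩ := mem_crossLine.1 hpL
    rw [← hs, binaryQuartic_smul, binaryQuartic_of_mem_quarticZeros ha, mul_zero]

/-- A mixed point of a graph lies over one of the four zeros of the quartic. -/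
theorem ncard_mixed_points_le {L : Submodule ℂ V} (hL : L ∈ secondKind) :
    {p : P3 | p.submodule ≤ L ∧ 1 ≤ multiplicity firstKind p}.Finite ∧
      {p : P3 | p.submodule ≤ L ∧ 1 ≤ multiplicity firstKind p}.ncard ≤ 4 := by
  rw [secondKind_eq] at hL
  obtain ⟨M, hM, rfl⟩ := hL
  have := finite_quarticZeros.to_subtype
  have hsub : {p : P3 | p.submodule ≤ graphLine M ∧ 1 ≤ multiplicity firstKind p} ⊆
      Set.range fun a : quarticZeros => Projectivization.mk ℂ (join a.1 (M.mulVec a.1))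
        (join_ne_zero_left (ne_zero_of_mem_quarticZeros a.2) _) := by
    rintro p ⟨hp, h1⟩
    obtain ⟨K, hK, hpK⟩ := exists_of_one_le_multiplicity h1
    obtain ⟨a, ha, b, hb, rfl⟩ := mem_firstKind.1 hK
    induction p using Projectivization.ind with
    | h x hx =>
      rw [submodule_mk_le] at hp hpK
      obtain ⟨⟨s, hs⟩, -⟩ := mem_crossLine.1 hpK
      have hs0 : s ≠ 0 := by
        rintro rfl
        exact head_ne_zero hx hp (by simp [← hs])
      refine ⟨⟨a, ha⟩, ?_⟩
      rw [Projectivization.mk_eq_mk_iff']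
      refine ⟨s⁻¹, ext_head_tail ?_ ?_⟩
      · simp [← hs, hs0]
      · rw [map_smul, mem_graphLine.1 hp, ← hs]
        simp [Matrix.mulVec_smul, hs0]
  refine ⟨(Set.finite_range _).subset hsub, (Set.ncard_le_ncard hsub (Set.finite_range _)).trans ?_⟩
  rw [← Set.image_univ]
  refine (Set.ncard_image_le Set.finite_univ).trans ?_
  rw [Set.ncard_univ, Nat.card_coe_set_eq, ncard_quarticZeros]

/-- Lines of the first kind can meet each other only on the axes. -/
theorem ncard_multiple_points_le {L : Submodule ℂ V} (hL : L ∈ firstKind) :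
    {p : P3 | p.submodule ≤ L ∧ 2 ≤ multiplicity firstKind p}.Finite ∧
      {p : P3 | p.submodule ≤ L ∧ 2 ≤ multiplicity firstKind p}.ncard ≤ 2 := by
  obtain ⟨a, ha, b, hb, rfl⟩ := mem_firstKind.1 hL
  have ha0 := ne_zero_of_mem_quarticZeros ha
  have hb0 := ne_zero_of_mem_quarticZeros hb
  have hsub : {p : P3 | p.submodule ≤ crossLine a b ∧ 2 ≤ multiplicity firstKind p} ⊆
      {Projectivization.mk ℂ (join a 0) (join_ne_zero_left ha0 0),
        Projectivization.mk ℂ (join 0 b) (join_ne_zero_right 0 hb0)} := by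
    rintro p ⟨hp, h2⟩
    induction p using Projectivization.ind with
    | h x hx =>
      rw [submodule_mk_le] at hp
      obtain ⟨⟨s, hs⟩, t, ht⟩ := mem_crossLine.1 hp
      by_cases hh : head x = 0
      · right
        rw [Set.mem_singleton_iff, Projectivization.mk_eq_mk_iff']
        exact ⟨t, ext_head_tail (by simp [hh]) (by simp [ht])⟩
      · by_cases htl : tail x = 0
        · left
          rw [Projectivization.mk_eq_mk_iff']
          exact ⟨s, ext_head_tail (by simp [hs]) (by simp [htl])⟩
        · rw [multiplicity_firstKind_eq_one ha hb hx hp hh htl] at h2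
          omega
  exact ⟨(Set.toFinite _).subset hsub, (Set.ncard_le_ncard hsub).trans
    ((Set.ncard_insert_le _ _).trans (by rw [Set.ncard_singleton]))⟩

theorem exists_twelve_mixed_points {L : Submodule ℂ V} (hL : L ∈ firstKind) :
    ∃ S : Set P3, S.ncard = 12 ∧
      ∀ p ∈ S, p.submodule ≤ L ∧ 1 ≤ multiplicity secondKind p := by
  obtain ⟨a, ha, b, hb, rfl⟩ := mem_firstKind.1 hL
  have ha0 := ne_zero_of_mem_quarticZeros ha
  have hb0 := ne_zero_of_mem_quarticZeros hb
  obtain ⟨T, hT, h⟩ := exists_ncard_eq_twelve_smul ha hb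
  refine ⟨(fun t : ℂ => Projectivization.mk ℂ (join a (t • b)) (join_ne_zero_left ha0 _)) '' T,
    ?_, ?_⟩
  · rw [Set.ncard_image_of_injective, hT]
    intro t t' htt'
    obtain ⟨s, hs⟩ := (Projectivization.mk_eq_mk_iff' _ _ _ _ _).1 htt'
    have e0 := congrArg head hs
    have e1 := congrArg tail hs
    rw [map_smul, head_join, head_join] at e0
    rw [map_smul, tail_join, tail_join] at e1
    have hs1 : s = 1 := smul_left_injective ℂ ha0 (by simpa using e0)
    subst hs1
    exact (smul_left_injective ℂ hb0 (by simpa using e1)).symm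
  · rintro _ ⟨t, ht, rfl⟩
    obtain ⟨M, hM, hMt⟩ := h t ht
    refine ⟨(submodule_mk_le _).2 (mem_crossLine.2 ⟨⟨1, by simp⟩, t, by simp⟩), ?_⟩
    refine one_le_multiplicity finite_secondKind (L := graphLine M) ?_ ?_
    · rw [secondKind_eq]; exact ⟨M, hM, rfl⟩
    · exact (submodule_mk_le _).2 (mem_graphLine.2 (by simp [hMt]))

/-! ### Connectedness of the union of the lines of the second kind -/

/-- The graphs of the symmetries `M` and `N` meet. -/
def GraphsMeet (M N : Matrix (Fin 2) (Fin 2) ℂ) : Prop :=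
  M ∈ quarticSymmetries ∧ N ∈ quarticSymmetries ∧ ∃ v, v ≠ 0 ∧ M.mulVec v = N.mulVec v

theorem GraphsMeet.symm {M N : Matrix (Fin 2) (Fin 2) ℂ} (h : GraphsMeet M N) : GraphsMeet N M :=
  ⟨h.2.1, h.1, h.2.2.imp fun _ hv => ⟨hv.1, hv.2.symm⟩⟩

theorem graphsMeet_of_cube_eq {b b' κ : ℂ} (hb : b ^ 12 = 729⁻¹) (hbb' : b ^ 3 = b' ^ 3)
    (hκ : κ ^ 3 = 1) : GraphsMeet (offDiagSymmetry b κ) (offDiagSymmetry b' κ) := by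
  refine ⟨offDiagSymmetry_mem hb hκ, offDiagSymmetry_mem ?_ hκ, ![1, 0], one_vec_ne_zero 0, ?_⟩
  · rw [← hb, show b' ^ 12 = (b' ^ 3) ^ 4 by ring, ← hbb']
    ring
  · ext i
    fin_cases i <;> simp [offDiagSymmetry, Matrix.mulVec, dotProduct, Fin.sum_univ_two, hbb']

theorem graphsMeet_of_eq {b κ κ' : ℂ} (hb : b ^ 12 = 729⁻¹) (hκ : κ ^ 3 = 1) (hκ' : κ' ^ 3 = 1) :
    GraphsMeet (offDiagSymmetry b κ) (offDiagSymmetry b κ') := by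
  refine ⟨offDiagSymmetry_mem hb hκ, offDiagSymmetry_mem hb hκ', ![b, -2 * (9 * b ^ 3)⁻¹], ?_, ?_⟩
  · intro h
    have : b = 0 := by simpa using congrFun h 0
    subst this
    norm_num at hb
  · ext i
    fin_cases i
    · simp [offDiagSymmetry, Matrix.mulVec, dotProduct, Fin.sum_univ_two]
    · simp only [offDiagSymmetry, Matrix.mulVec, dotProduct, Fin.sum_univ_two, Matrix.of_apply,
        Fin.mk_one, Matrix.cons_val', Matrix.cons_val_zero, Matrix.cons_val_one,
        Matrix.cons_val_fin_one]
      ring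

theorem graphsMeet_one_fixingSymmetry {e : ℂ} (he : e ^ 4 = 9) :
    GraphsMeet (fixingSymmetry (1 - e) e) 1 := by
  obtain ⟨-, h1, -⟩ := ne_of_pow_four_eq_nine he
  have h := fixingSymmetry_mem_fixer (sub_ne_zero.2 h1.symm) he rfl
  exact ⟨h.1, one_mem_quarticSymmetries, _, one_vec_ne_zero (1 - e), by
    rw [h.2, Matrix.one_mulVec]⟩

/-- The chain first changes b with b³ fixed, then κ, until it reaches a symmetry that fixes (1, 1 -
e) and therefore meets the identity. The choice y = 1 - e makes (1 - e)³ = y³ hold trivially. -/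
theorem reflTransGen_offDiagSymmetry_one {b κ : ℂ} (hb : b ^ 12 = 729⁻¹) (hκ : κ ^ 3 = 1) :
    Relation.ReflTransGen GraphsMeet (offDiagSymmetry b κ) 1 := by
  obtain ⟨e, hbe⟩ : ∃ e : ℂ, b ^ 3 = -e / 9 := ⟨-9 * b ^ 3, by ring⟩
  have he : e ^ 4 = 9 := by
    have : b ^ 12 = (b ^ 3) ^ 4 := by ring
    rw [this, hbe] at hb
    norm_num at hb
    linear_combination 6561 * hb
  obtain ⟨h0, h1, h3⟩ := ne_of_pow_four_eq_nine he
  have hy : 1 - e ≠ 0 := sub_ne_zero.2 h1.symm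
  have hc := fixingSymmetry_cube hy he rfl
  have hκ' : (e * (1 - e) / (e - 3)) ^ 3 = 1 := by
    rw [div_pow, div_eq_one_iff_eq (pow_ne_zero 3 (sub_ne_zero.2 h3))]
    linear_combination (3 * e - 3 - e ^ 2) * he
  refine .head (graphsMeet_of_cube_eq hb (hbe.trans hc.symm) hκ)
    (.head (graphsMeet_of_eq ?_ hκ hκ') (.single (graphsMeet_one_fixingSymmetry he)))
  rw [← hb, show ∀ x : ℂ, x ^ 12 = (x ^ 3) ^ 4 by intro x; ring, hc, ← hbe]
  ring

theorem reflTransGen_one {M : Matrix (Fin 2) (Fin 2) ℂ} (hM : M ∈ quarticSymmetries) :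
    Relation.ReflTransGen GraphsMeet M 1 := by
  rcases mem_quarticSymmetries_iff.1 hM with ⟨d, hd, rfl⟩ | ⟨b, κ, hb, hκ, rfl⟩
  · obtain ⟨e, he⟩ := IsAlgClosed.exists_pow_nat_eq (9 : ℂ) (n := 4) (by norm_num)
    have hF := graphsMeet_one_fixingSymmetry he
    obtain ⟨h0, h1, h3⟩ := ne_of_pow_four_eq_nine he
    have hd0 : d ≠ 0 := by rintro rfl; norm_num at hd
    have hN := mul_mem_quarticSymmetries hM hF.1
    -- Left multiplication by the diagonal symmetry carries the meeting of the identity with an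
    -- off-diagonal symmetry to a meeting with another off-diagonal one, which reduces to the case
    -- already treated.
    have hmeet : GraphsMeet (diagSymmetry d) (diagSymmetry d * fixingSymmetry (1 - e) e) := by
      obtain ⟨v, hv, h⟩ := hF.2.2
      exact ⟨hM, hN, v, hv, by rw [← Matrix.mulVec_mulVec, h, Matrix.one_mulVec]⟩
    refine .head hmeet ?_
    rcases mem_quarticSymmetries_iff.1 hN with ⟨d', hd', h⟩ | ⟨b, κ, hb, hκ, h⟩
    · exfalso
      have := congrFun (congrFun h 0) 1
      simp [diagSymmetry, fixingSymmetry, offDiagSymmetry, Matrix.mul_apply, Fin.sum_univ_two, h0,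
        hd0, sub_eq_zero, h1, h1.symm] at this
    · rw [h]
      exact reflTransGen_offDiagSymmetry_one hb hκ
  · exact reflTransGen_offDiagSymmetry_one hb hκ

theorem isConnected_ne_zero : IsConnected {v : Fin 2 → ℂ | v ≠ 0} := by
  refine isConnected_compl_singleton_of_one_lt_rank (Module.lt_rank_of_lt_finrank ?_) 0
  simp [Module.finrank_pi_fintype]

/-- The line is the continuous image of ℂ² ∖ {0}, which is connected because its real dimension
exceeds one. -/
theorem isConnected_graphLine (M : Matrix (Fin 2) (Fin 2) ℂ) :
    IsConnected {p : P3 | p.submodule ≤ graphLine M} := by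
  have : ConnectedSpace {v : Fin 2 → ℂ // v ≠ 0} :=
    isConnected_iff_connectedSpace.1 isConnected_ne_zero
  let f : {v : Fin 2 → ℂ // v ≠ 0} → P3 := fun v =>
    Projectivization.mk' ℂ ⟨join v.1 (M.mulVec v.1), join_ne_zero_left v.2 _⟩
  have hf : Continuous f := by
    have hg : Continuous fun v : Fin 2 → ℂ => join v (M.mulVec v) := by
      refine continuous_pi fun i => ?_
      fin_cases i <;> simp [join, Matrix.mulVec, dotProduct, Fin.sum_univ_two] <;> fun_prop
    exact continuous_coinduced_rng.comp ((hg.comp continuous_subtype_val).subtype_mk _)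
  have hrange : {p : P3 | p.submodule ≤ graphLine M} = Set.range f := by
    ext p
    constructor
    · intro hp
      induction p using Projectivization.ind with
      | h x hx =>
        rw [Set.mem_ofPred_eq, submodule_mk_le] at hp
        refine ⟨⟨head x, head_ne_zero hx hp⟩, ?_⟩
        simp only [f, ← mem_graphLine.1 hp, join_head_tail]
        rfl
    · rintro ⟨v, rfl⟩
      exact (submodule_mk_le _).2 (join_mulVec_mem_graphLine M v.1)
  rw [hrange]
  exact isConnected_range hf

theorem isConnected_unionOfLines_secondKind : IsConnected (unionOfLines secondKind) := by
  have hU : unionOfLines secondKind =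
      ⋃ M ∈ quarticSymmetries, {p : P3 | p.submodule ≤ graphLine M} := by
    ext p
    simp [unionOfLines, secondKind_eq]
  rw [hU]
  refine IsConnected.biUnion_of_reflTransGen ⟨1, one_mem_quarticSymmetries⟩
    (fun M _ => isConnected_graphLine M) fun M hM N hN => ?_
  have : Std.Symm GraphsMeet := ⟨fun _ _ h => h.symm⟩
  have h := (reflTransGen_one hM).trans
    (Relation.ReflTransGen.stdSymm.symm _ _ (reflTransGen_one hN))
  refine Relation.ReflTransGen.mono (fun A B hAB => ⟨?_, hAB.1⟩) _ _ h
  obtain ⟨hA, hB, v, hv, h⟩ := hAB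
  exact ⟨Projectivization.mk ℂ (join v (A.mulVec v)) (join_ne_zero_left hv _),
    (submodule_mk_le _).2 (join_mulVec_mem_graphLine A v),
    (submodule_mk_le _).2 (h ▸ join_mulVec_mem_graphLine B v)⟩

theorem isTransversalArrangement_secondKind :
    IsTransversalArrangement schurQuartic secondKind where
  finite := finite_secondKind
  subset := fun _ h => h.1
  transversal := fun _ hL _ hM hne _ hv hv0 => sup_eq_tangentSpace hL.1 hM.1 hne hv hv0
  connected := isConnected_unionOfLines_secondKind

/-! ### Counting multiple points -/

open Classical in
theorem sum_mul_t_eq {C : Set (Submodule ℂ V)} (hC : C.Finite) {P : Finset P3}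
    (hP : ∀ p, 2 ≤ multiplicity C p → p ∈ P) (g : ℕ → ℤ) :
    ∑ k ∈ Finset.Icc 2 C.ncard, g k * t C k =
      ∑ p ∈ P, if 2 ≤ multiplicity C p then g (multiplicity C p) else 0 := by
  rw [← Finset.sum_filter, ← Finset.sum_fiberwise_of_maps_to (s := P.filter _)
    (t := Finset.Icc 2 C.ncard) (g := multiplicity C)]
  · refine Finset.sum_congr rfl fun k hk => ?_
    rw [Finset.sum_congr rfl (g := fun _ => g k) fun p hp => by rw [(Finset.mem_filter.1 hp).2],
      Finset.sum_const, nsmul_eq_mul, mul_comm]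
    congr 2
    rw [t, ← Set.ncard_coe_finset]
    congr 1
    ext p
    have h2 := (Finset.mem_Icc.1 hk).1
    simp only [Set.mem_ofPred_eq, Finset.coe_filter, Finset.mem_filter]
    constructor
    · rintro rfl
      exact ⟨⟨hP p h2, h2⟩, rfl⟩
    · exact fun h => h.2
  · intro p hp
    exact Finset.mem_Icc.2 ⟨(Finset.mem_filter.1 hp).2, multiplicity_le_ncard hC p⟩

/-- The contribution of a point of multiplicity `k` to `36 f₀ - 11 f₁`. -/
def pointWeight (k : ℕ) : ℤ := if 2 ≤ k then 36 - 11 * k else 0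

theorem sum_pointWeight {C : Set (Submodule ℂ V)} (hC : C.Finite) {P : Finset P3}
    (hP : ∀ p, 2 ≤ multiplicity C p → p ∈ P) :
    ∑ p ∈ P, pointWeight (multiplicity C p) = 36 * (f₀ C : ℤ) - 11 * f₁ C := by
  simp only [pointWeight]
  rw [← sum_mul_t_eq hC hP (fun k => 36 - 11 * (k : ℤ)), f₀, f₁]
  push_cast
  rw [Finset.mul_sum, Finset.mul_sum, ← Finset.sum_sub_distrib]
  exact Finset.sum_congr rfl fun k _ => by ring

-- Double counting of the incidences between points and lines, with a weight on every point. It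
-- turns pointwise estimates into estimates along single lines.
open Classical in
theorem sum_mul_multiplicity (P : Finset P3) (D : Finset (Submodule ℂ V)) (α : P3 → ℤ) :
    ∑ p ∈ P, α p * multiplicity (D : Set (Submodule ℂ V)) p =
      ∑ L ∈ D, ∑ p ∈ P with p.submodule ≤ L, α p := by
  have h : ∀ p, (multiplicity (D : Set (Submodule ℂ V)) p : ℤ) =
      ∑ L ∈ D, if p.submodule ≤ L then 1 else 0 := by
    intro p
    rw [Finset.sum_boole, multiplicity, ← Set.ncard_coe_finset]
    congr 2
    ext L
    simp
  simp only [h, Finset.mul_sum, Finset.sum_filter]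
  rw [Finset.sum_comm]
  simp

theorem mul_t_eq {C : Set (Submodule ℂ V)} (hC : C ⊆ linesOn schurQuartic) {k n : ℕ} (hk : 2 ≤ k)
    (h : ∀ L ∈ C, {p : P3 | p.submodule ≤ L ∧ multiplicity C p = k}.ncard = n) :
    k * t C k = C.ncard * n := by
  classical
  have hfin := finite_linesOn.subset hC
  have hkfin : {p | multiplicity C p = k}.Finite :=
    (finite_setOf_two_le_multiplicity hC).subset fun p hp => hk.trans (le_of_eq hp.symm)
  have key := sum_mul_multiplicity hkfin.toFinset hfin.toFinset fun _ => 1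
  rw [hfin.coe_toFinset] at key
  have h1 : ∑ p ∈ hkfin.toFinset, (1 : ℤ) * multiplicity C p = k * t C k := by
    rw [Finset.sum_congr rfl (g := fun _ => (k : ℤ)) fun p hp => by
      rw [one_mul, (hkfin.mem_toFinset.1 hp : multiplicity C p = k)], Finset.sum_const,
      ← Set.ncard_eq_toFinset_card _ hkfin, nsmul_eq_mul, mul_comm, t]
  have h2 : ∑ L ∈ hfin.toFinset, ∑ p ∈ hkfin.toFinset with p.submodule ≤ L, (1 : ℤ) =
      C.ncard * n := by
    rw [Finset.sum_congr rfl (g := fun _ => (n : ℤ)) fun L hL => by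
      rw [← h L (hfin.mem_toFinset.1 hL), Finset.sum_const, nsmul_eq_mul, mul_one,
        ← Set.ncard_coe_finset]
      congr 2
      ext p
      simp [and_comm], Finset.sum_const,
      ← Set.ncard_eq_toFinset_card _ hfin, nsmul_eq_mul]
  rw [h1, h2] at key
  exact_mod_cast key

theorem t_secondKind_two : t secondKind 2 = 144 := by
  have := mul_t_eq (C := secondKind) (fun _ h => h.1) le_rfl fun L hL => ncard_double_points hL
  rw [ncard_secondKind] at this
  omega

theorem t_secondKind_three : t secondKind 3 = 64 := by
  have := mul_t_eq (C := secondKind) (fun _ h => h.1) (by norm_num)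
    fun L hL => ncard_triple_points hL
  rw [ncard_secondKind] at this
  omega

theorem t_secondKind_of_four_le {k : ℕ} (hk : 4 ≤ k) : t secondKind k = 0 := by
  have hempty : {p : P3 | multiplicity secondKind p = k} = ∅ := by
    rw [Set.eq_empty_iff_forall_notMem]
    intro p hp
    have h1 : multiplicity secondKind p = k := hp
    have := multiplicity_secondKind_le p
    omega
  rw [t, hempty, Set.ncard_empty]

theorem sum_Icc_secondKind (g : ℕ → ℕ) :
    ∑ k ∈ Finset.Icc 2 secondKind.ncard, g k * t secondKind k = g 2 * 144 + g 3 * 64 := by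
  rw [ncard_secondKind, ← Finset.sum_subset (s₁ := {2, 3}) (by decide),
    Finset.sum_pair (by norm_num), t_secondKind_two, t_secondKind_three]
  intro k hk hk'
  simp at hk hk'
  rw [t_secondKind_of_four_le (by omega), mul_zero]

theorem f₀_secondKind : f₀ secondKind = 208 := by
  simpa [f₀] using sum_Icc_secondKind fun _ => 1

theorem f₁_secondKind : f₁ secondKind = 480 := sum_Icc_secondKind fun k => k

theorem logChernSlope_secondKind : logChernSlope secondKind = 64 / 25 := by
  simp only [logChernSlope, logChernOneSq, logChernTwo, ncard_secondKind, f₀_secondKind,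
    f₁_secondKind]
  norm_num

/-- Clearing denominators in the slope equation leaves this linear relation between f₀ and f₁. -/
theorem weight_eq_of_slope {C : Set (Submodule ℂ V)} (hn : C.ncard = 48)
    (h : logChernSlope C = 64 / 25) : 36 * (f₀ C : ℤ) - 11 * f₁ C = 2208 := by
  simp only [logChernSlope, logChernOneSq, logChernTwo, hn] at h
  -- If the second log Chern number vanished, the quotient would be 0 by convention, not 64/25.
  by_cases h0 : ((24 - 2 * (48 : ℕ) + f₁ C - f₀ C : ℤ) : ℚ) = 0
  · rw [h0, div_zero] at h
    norm_num at h
  · rw [div_eq_div_iff h0 (by norm_num)] at h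
    have h' : (-2 * (48 : ℕ) + 3 * f₁ C - 4 * f₀ C : ℤ) * 25 =
        64 * (24 - 2 * (48 : ℕ) + f₁ C - f₀ C : ℤ) := by exact_mod_cast h
    push_cast at h'
    omega

/-! ### Uniqueness of the arrangement -/

/-- Exchanging `d` of the `m₂` lines of the second kind through a point for `a` of its `m₁` lines
of the first kind. -/
theorem pointWeight_exchange {m₁ m₂ a d c : ℕ} (h1 : m₁ ≤ 4) (h2 : m₂ ≤ 3)
    (hmix : 1 ≤ m₁ → 1 ≤ m₂ → m₁ = 1 ∧ m₂ = 1) (hm : 2 ≤ m₁ + m₂) (ha : a ≤ m₁) (hd : d ≤ m₂)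
    (hc : c + d = a + m₂) :
    2 * pointWeight m₂ + (if m₂ = 0 then -4 else 28) * a - (if m₂ = 3 then 3 else 28) * d ≤
      2 * pointWeight c := by
  obtain rfl : c = a + m₂ - d := by omega
  -- The coefficients are dictated by the tight cases. Doubled weights of 2-, 3- and 4-fold points
  -- are 28, 6 and -16. A full fourfold point on an axis gives -16/4 = -4 per line; a mixed point
  -- turned double gives 28; removing two of three lines at a triple point loses 6, or 3 per line;
  -- removing one line at a double point loses 28.
  interval_cases m₁ <;> interval_cases m₂ <;> first
    | omega
    | (interval_cases a <;> interval_cases d <;> simp [pointWeight])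

-- At least 12 mixed points contribute 28 each, and at most 2 points on the axes contribute -4 each:
-- 12 · 28 - 2 · 4 = 328.
open Classical in
theorem le_sum_weight_firstKind {P : Finset P3}
    (hP : ∀ p, p ∈ P ↔ 2 ≤ multiplicity firstKind p + multiplicity secondKind p)
    {L : Submodule ℂ V} (hL : L ∈ firstKind) :
    328 ≤ ∑ p ∈ P with p.submodule ≤ L, if multiplicity secondKind p = 0 then (-4 : ℤ) else 28 := by
  rw [Finset.sum_ite, Finset.sum_const, Finset.sum_const, nsmul_eq_mul, nsmul_eq_mul]
  have h1 : ((P.filter (·.submodule ≤ L)).filter (multiplicity secondKind · = 0)).card ≤ 2 := by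
    obtain ⟨hfin, h⟩ := ncard_multiple_points_le hL
    rw [← Set.ncard_coe_finset]
    refine (Set.ncard_le_ncard (fun p hp => ?_) hfin).trans h
    simp only [Finset.coe_filter, Finset.mem_filter, Set.mem_ofPred_eq, hP] at hp ⊢
    exact ⟨hp.1.2, by omega⟩
  have h2 : 12 ≤ ((P.filter (·.submodule ≤ L)).filter (¬ multiplicity secondKind · = 0)).card := by
    obtain ⟨S, hS, h⟩ := exists_twelve_mixed_points hL
    rw [← Set.ncard_coe_finset, ← hS]
    refine Set.ncard_le_ncard (fun p hp => ?_) (Finset.finite_toSet _)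
    obtain ⟨hpL, hp2⟩ := h p hp
    have hp1 := one_le_multiplicity finite_firstKind hL hpL
    simp only [Finset.coe_filter, Finset.mem_filter, Set.mem_ofPred_eq, hP]
    exact ⟨⟨by omega, hpL⟩, by omega⟩
  omega

-- Four triple points contribute 3 each, and at most 6 double and 4 mixed points contribute 28 each:
-- 4 · 3 + 10 · 28 = 292.
open Classical in
theorem sum_weight_secondKind_le {P : Finset P3}
    (hP : ∀ p, p ∈ P ↔ 2 ≤ multiplicity firstKind p + multiplicity secondKind p)
    {L : Submodule ℂ V} (hL : L ∈ secondKind) :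
    ∑ p ∈ P with p.submodule ≤ L, (if multiplicity secondKind p = 3 then (3 : ℤ) else 28) ≤
      292 := by
  rw [Finset.sum_ite, Finset.sum_const, Finset.sum_const, nsmul_eq_mul, nsmul_eq_mul]
  have h1 : ((P.filter (·.submodule ≤ L)).filter (multiplicity secondKind · = 3)).card ≤ 4 := by
    have h := ncard_triple_points hL
    rw [← Set.ncard_coe_finset]
    refine (Set.ncard_le_ncard (fun p hp => ?_)
      (Set.finite_of_ncard_ne_zero (by rw [h]; norm_num))).trans h.le
    simp only [Finset.coe_filter, Finset.mem_filter, Set.mem_ofPred_eq] at hp ⊢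
    exact ⟨hp.1.2, hp.2⟩
  have h2 : ((P.filter (·.submodule ≤ L)).filter (¬ multiplicity secondKind · = 3)).card ≤ 10 := by
    have hd := ncard_double_points hL
    obtain ⟨hfin, hm⟩ := ncard_mixed_points_le hL
    have hdfin := Set.finite_of_ncard_ne_zero (by rw [hd]; norm_num)
    rw [← Set.ncard_coe_finset]
    refine (Set.ncard_le_ncard (fun p hp => ?_) (hdfin.union hfin)).trans
      ((Set.ncard_union_le _ _).trans (by rw [hd]; omega))
    simp only [Finset.coe_filter, Finset.mem_filter, Set.mem_ofPred_eq, hP, Set.mem_union] at hp ⊢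
    have := multiplicity_secondKind_le p
    by_cases h0 : 1 ≤ multiplicity firstKind p
    · exact Or.inr ⟨hp.1.2, h0⟩
    · exact Or.inl ⟨hp.1.2, by omega⟩
  omega

theorem eq_secondKind_of_slope {C : Set (Submodule ℂ V)} (hsub : C ⊆ linesOn schurQuartic)
    (hn : C.ncard = 48) (hslope : logChernSlope C = 64 / 25) : C = secondKind := by
  classical
  have hCfin := finite_linesOn.subset hsub
  set A := C ∩ firstKind with hA
  set D := secondKind \ C with hD
  have hAfin : A.Finite := finite_firstKind.subset fun _ h => h.2
  have hDfin : D.Finite := finite_secondKind.subset fun _ h => h.1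
  have hAS : Disjoint A secondKind := disjoint_firstKind_secondKind.mono_left fun _ h => h.2
  have hCD : Disjoint C D := Set.disjoint_sdiff_right
  have hunion : C ∪ D = A ∪ secondKind := by
    ext L
    have h1 : L ∈ C → L ∈ firstKind ∪ secondKind := fun h => by rw [← linesOn_eq]; exact hsub h
    simp only [hA, hD, Set.mem_union, Set.mem_inter_iff, Set.mem_sdiff] at h1 ⊢
    tauto
  have hcard : A.ncard = D.ncard := by
    have h1 := Set.ncard_union_eq hCD hCfin hDfin
    have h2 := Set.ncard_union_eq hAS hAfin finite_secondKind
    rw [hunion, h2, hn, ncard_secondKind] at h1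
    omega
  have hmult (p : P3) :
      multiplicity C p + multiplicity D p = multiplicity A p + multiplicity secondKind p := by
    rw [← multiplicity_union hCfin hDfin hCD, hunion,
      multiplicity_union hAfin finite_secondKind hAS]
  have hall (p : P3) : multiplicity (linesOn schurQuartic) p =
      multiplicity firstKind p + multiplicity secondKind p := by
    rw [linesOn_eq, multiplicity_union finite_firstKind finite_secondKind
      disjoint_firstKind_secondKind]
  -- The multiple points of all 64 lines serve as a common index set that contains the multiple
  -- points of both arrangements.
  set P := (finite_setOf_two_le_multiplicity (subset_refl (linesOn schurQuartic))).toFinset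
    with hPdef
  have hP : ∀ p, p ∈ P ↔ 2 ≤ multiplicity firstKind p + multiplicity secondKind p := by
    intro p
    rw [hPdef, Set.Finite.mem_toFinset, Set.mem_ofPred_eq, hall]
  have hsum : ∑ p ∈ P, (2 * pointWeight (multiplicity secondKind p) +
      (if multiplicity secondKind p = 0 then -4 else 28) * (multiplicity A p : ℤ) -
      (if multiplicity secondKind p = 3 then 3 else 28) * (multiplicity D p : ℤ)) ≤
      ∑ p ∈ P, 2 * pointWeight (multiplicity C p) :=
    Finset.sum_le_sum fun p hp => pointWeight_exchange (multiplicity_firstKind_le p)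
      (multiplicity_secondKind_le p) multiplicity_eq_one_of_mixed ((hP p).1 hp)
      (multiplicity_mono (fun _ h => h.2) finite_firstKind p)
      (multiplicity_mono (fun _ h => h.1) finite_secondKind p) (hmult p)
  rw [Finset.sum_sub_distrib, Finset.sum_add_distrib, ← Finset.mul_sum, ← Finset.mul_sum,
    sum_pointWeight finite_secondKind (fun p hp => (hP p).2 (by omega)),
    sum_pointWeight hCfin (fun p hp => (hP p).2 (hall p ▸
      hp.trans (multiplicity_mono hsub finite_linesOn p))),
    weight_eq_of_slope hn hslope,
    weight_eq_of_slope ncard_secondKind logChernSlope_secondKind] at hsum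
  have hα := sum_mul_multiplicity P hAfin.toFinset
    fun p => if multiplicity secondKind p = 0 then -4 else 28
  have hβ := sum_mul_multiplicity P hDfin.toFinset
    fun p => if multiplicity secondKind p = 3 then 3 else 28
  rw [hAfin.coe_toFinset] at hα
  rw [hDfin.coe_toFinset] at hβ
  have hα' := Finset.card_nsmul_le_sum hAfin.toFinset _ 328 fun L hL =>
    le_sum_weight_firstKind hP (hAfin.mem_toFinset.1 hL).2
  have hβ' := Finset.sum_le_card_nsmul hDfin.toFinset _ 292 fun L hL =>
    sum_weight_secondKind_le hP (hDfin.mem_toFinset.1 hL).1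
  rw [← Set.ncard_eq_toFinset_card _ hAfin, nsmul_eq_mul] at hα'
  rw [← Set.ncard_eq_toFinset_card _ hDfin, nsmul_eq_mul] at hβ'
  rw [hα, hβ] at hsum
  -- The total weights of both arrangements are equal and cancel, so 328|A| ≤ 292|D| remains, while
  -- |A| = |D|.
  have hD0 : D.ncard = 0 := by omega
  have hsubset : secondKind ⊆ C := by
    rw [Set.ncard_eq_zero hDfin] at hD0
    exact Set.sdiff_eq_empty.1 hD0
  exact (Set.eq_of_subset_of_ncard_le hsubset (by rw [hn, ncard_secondKind]) hCfin).symm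

end SchurQuarticLines

end

theorem mainTheorem3 :
    SchurQuarticLines.IsSmoothQuartic SchurQuarticLines.schurQuartic ∧
    (SchurQuarticLines.linesOn SchurQuarticLines.schurQuartic).ncard = 64 ∧
    SchurQuarticLines.firstKind.ncard = 16 ∧
    SchurQuarticLines.secondKind.ncard = 48 ∧
    SchurQuarticLines.IsTransversalArrangement SchurQuarticLines.schurQuartic
      SchurQuarticLines.secondKind ∧
    SchurQuarticLines.t SchurQuarticLines.secondKind 2 = 144 ∧
    SchurQuarticLines.t SchurQuarticLines.secondKind 3 = 64 ∧
    (∀ k : ℕ, 4 ≤ k → SchurQuarticLines.t SchurQuarticLines.secondKind k = 0) ∧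
    SchurQuarticLines.logChernSlope SchurQuarticLines.secondKind = 64 / 25 ∧
    5 / 2 < SchurQuarticLines.logChernSlope SchurQuarticLines.secondKind ∧
    SchurQuarticLines.logChernSlope SchurQuarticLines.secondKind < 8 / 3 ∧
    (∃! C : Set (Submodule ℂ SchurQuarticLines.V),
      C.ncard = 48 ∧
      SchurQuarticLines.IsTransversalArrangement SchurQuarticLines.schurQuartic C ∧
      SchurQuarticLines.logChernSlope C = 64 / 25) := by
  open SchurQuarticLines in
  refine ⟨isSmoothQuartic_schurQuartic, ncard_linesOn, ncard_firstKind, ncard_secondKind,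
    isTransversalArrangement_secondKind, t_secondKind_two, t_secondKind_three,
    fun k hk => t_secondKind_of_four_le hk, logChernSlope_secondKind, ?_, ?_, secondKind,
    ⟨ncard_secondKind, isTransversalArrangement_secondKind, logChernSlope_secondKind⟩,
    fun C hC => eq_secondKind_of_slope hC.2.1.subset hC.1 hC.2.2⟩ <;>
  · rw [logChernSlope_secondKind]; norm_num
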